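/- Let $G$ be a compact group with normalized Haar measure $\mathrm dg$, and let $\{U_g\}_{g\in G}$ and $\{V_g\}_{g\in G}$ be continuous unitary representations of $G$ on $\mathbb C^{d_{\rm in}}$ and $\mathbb C^{d_{\rm out}}$, with $d_{\rm out}\ge 1$. For a unitary $W$ on $\mathbb C^d$ put $|\Phi\rangle=d^{-1/2}\sum_{n=1}^d|n\rangle\otimes|n\rangle$ and $|\Phi_W\rangle=(W\otimes I)|\Phi\rangle$; write $|\Phi_{\rm out}\rangle$ for $|\Phi\rangle$ with $d=d_{\rm out}$. A quantum channel is a completely positive trace-preserving map, and a quantum operation is a completely positive trace-non-increasing map. Bell state conversion. Define $$F^{\rm det}_{\rm Bell}=\sup_{\mathcal C}\int \mathrm dg\,\langle\Phi_{V_g}|\,\sigma_g\,|\Phi_{V_g}\rangle ,\qquad \sigma_g=\mathcal C(|\Phi_{U_g}\rangle\langle\Phi_{U_g}|),$$ over all channels $\mathcal C$ from operators on $\mathbb C^{d_{\rm in}}\otimes\mathbb C^{d_{\rm in}}$ to operators on $\mathbb C^{d_{\rm out}}\otimes\mathbb C^{d_{\rm out}}$. Define $$F^{\rm prob}_{\rm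 Bell}=\sup_{\mathcal M}\int p(\mathrm dg|{\rm succ})\,\langle\Phi_{V_g}|\,\rho'_g\,|\Phi_{V_g}\rangle$$ over all quantum operations $\mathcal M$ between the same spaces with $p_{\rm succ}>0$, where $\sigma_g=\mathcal M(|\Phi_{U_g}\rangle\langle\Phi_{U_g}|)$, $p({\rm succ}|g)=\mathrm{Tr}\,\sigma_g$, $p_{\rm succ}=\int \mathrm dg\,\mathrm{Tr}\,\sigma_g$, $p(\mathrm dg|{\rm succ})=p({\rm succ}|g)\,\mathrm dg/p_{\rm succ}$ and $\rho'_g=\sigma_g/\mathrm{Tr}\,\sigma_g$. Gate simulation. A network with one open slot consists of a finite-dimensional memory $\mathbb C^m$ and two maps, $\mathcal A$ from operators on $\mathbb C^{d_{\rm out}}$ to operators on $\mathbb C^{d_{\rm in}}\otimes\mathbb C^m$ and $\mathcal B$ from operators on $\mathbb C^{d_{\rm in}}\otimes\mathbb C^m$ to operators on $\mathbb C^{d_{\rm out}}$. It is deterministic if $\mathcal A$ and $\mathcal B$ are channels, and probabilistic if they are quantum operations. With $U_g$ in the slot it performs $\mathcal Q_g(X)=\mathcal B\big((U_g\otimes I)\,\mathcal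 A(X)\,(U_g\otimes I)^\dagger\big)$. Let $F^{\rm det}_{\rm gate}$ and $F^{\rm prob}_{\rm gate}$ be defined as the two quantities above with $\sigma_g=(\mathcal Q_g\otimes\mathcal I)(|\Phi_{\rm out}\rangle\langle\Phi_{\rm out}|)$, the suprema being over all deterministic networks and over all probabilistic networks with $p_{\rm succ}>0$, respectively. Then: (1) If $\{U_g\}$ is irreducible, then $F^{\rm det}_{\rm Bell}[|\Phi_{U_g}\rangle\to|\Phi_{V_g}\rangle]=F^{\rm prob}_{\rm Bell}[|\Phi_{U_g}\rangle\to|\Phi_{V_g}\rangle]$. (2) If both $\{U_g\}$ and $\{V_g\}$ are irreducible, then $F^{\rm det}_{\rm gate}[U_g\to V_g]=F^{\rm prob}_{\rm gate}[U_g\to V_g]$. -/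

import Mathlib

open scoped Matrix Kronecker ComplexOrder
open MeasureTheory

noncomputable section

namespace BellConversion

/-! ### States -/

section States

variable {a : Type*} [Fintype a] [DecidableEq a]

/-- The canonical Bell state `|Φ⟩ = d^{-1/2} ∑ₙ |n⟩ ⊗ |n⟩` of two copies of the Hilbert space
`ℂ^a`, where `d` is the number of elements of `a`. -/
def bellVec (a : Type*) [Fintype a] [DecidableEq a] : a × a → ℂ :=
  fun p => if p.1 = p.2 then (((Real.sqrt (Fintype.card a))⁻¹ : ℝ) : ℂ) else 0

/-- The Bell state `|Φ_W⟩ = (W ⊗ I)|Φ⟩`. -/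
def bellVecOf (W : Matrix a a ℂ) : a × a → ℂ :=
  (W ⊗ₖ (1 : Matrix a a ℂ)) *ᵥ bellVec a

/-- The rank one operator `|ψ⟩⟨ψ|`. -/
def ketBra (ψ : a → ℂ) : Matrix a a ℂ :=
  Matrix.vecMulVec ψ (star ψ)

/-- The overlap `⟨ψ|σ|ψ⟩` of an operator `σ` with the pure state `|ψ⟩`; it is the fidelity if `σ`
is a density matrix. -/
def overlap (ψ : a → ℂ) (σ : Matrix a a ℂ) : ℝ :=
  (star ψ ⬝ᵥ (σ *ᵥ ψ)).re

/-- The (real) trace of an operator. -/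
def reTrace (σ : Matrix a a ℂ) : ℝ :=
  σ.trace.re

end States

/-! ### Quantum channels and quantum operations -/

section Maps

variable {a b : Type*}

/-- The action of `Φ ⊗ id` on operators on `ℂ^a ⊗ ℂ^c`. -/
def applyLeft (c : Type*) (Φ : Matrix a a ℂ →ₗ[ℂ] Matrix b b ℂ)
    (X : Matrix (a × c) (a × c) ℂ) : Matrix (b × c) (b × c) ℂ :=
  Matrix.of fun p q => Φ (Matrix.of fun i j => X (i, p.2) (j, q.2)) p.1 q.1

/-- Complete positivity: `Φ ⊗ id` preserves positivity, for every finite-dimensional ancilla. -/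
def IsCompletelyPositive (Φ : Matrix a a ℂ →ₗ[ℂ] Matrix b b ℂ) : Prop :=
  ∀ (k : ℕ) (X : Matrix (a × Fin k) (a × Fin k) ℂ),
    X.PosSemidef → (applyLeft (Fin k) Φ X).PosSemidef

variable [Fintype a] [Fintype b]

/-- Quantum channels: completely positive trace-preserving maps. -/
structure IsChannel (Φ : Matrix a a ℂ →ₗ[ℂ] Matrix b b ℂ) : Prop where
  completelyPositive : IsCompletelyPositive Φ
  trace_map : ∀ X : Matrix a a ℂ, (Φ X).trace = X.trace

/-- Quantum operations: completely positive trace-non-increasing maps. -/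
structure IsQuantumOperation (Φ : Matrix a a ℂ →ₗ[ℂ] Matrix b b ℂ) : Prop where
  completelyPositive : IsCompletelyPositive Φ
  trace_map_le : ∀ X : Matrix a a ℂ, X.PosSemidef → reTrace (Φ X) ≤ reTrace X

/-- The map `X ↦ W X W†`. -/
def conjBy (W : Matrix a a ℂ) : Matrix a a ℂ →ₗ[ℂ] Matrix a a ℂ where
  toFun X := W * X * Wᴴ
  map_add' X Y := by rw [Matrix.mul_add, Matrix.add_mul]
  map_smul' c X := by simp

end Maps

/-! ### Average fidelities -/

section Average

variable {G : Type*} [MeasurableSpace G] (μ : Measure G)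
  {s : Type*} [Fintype s]

/-- The average fidelity `∫ dg ⟨ψ_g|σ_g|ψ_g⟩` of the output states `σ_g` with the targets `ψ_g`. -/
def detFidelity (ψ : G → s → ℂ) (σ : G → Matrix s s ℂ) : ℝ :=
  ∫ g, overlap (ψ g) (σ g) ∂μ

/-- The total success probability `∫ dg Tr σ_g`, where `σ_g` is the unnormalized output state. -/
def totalSuccess (σ : G → Matrix s s ℂ) : ℝ :=
  ∫ g, reTrace (σ g) ∂μ

/-- The average fidelity conditional on success, `∫ p(dg|succ) ⟨ψ_g|ρ'_g|ψ_g⟩`, where `σ_g` is the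
unnormalized output state, `p(succ|g) = Tr σ_g` is the probability of success,
`p(dg|succ) = p(succ|g) dg / p_succ`, and `ρ'_g = σ_g / p(succ|g)` is the output state. -/
def probFidelity (ψ : G → s → ℂ) (σ : G → Matrix s s ℂ) : ℝ :=
  ∫ g, reTrace (σ g) / totalSuccess μ σ * overlap (ψ g) ((reTrace (σ g))⁻¹ • σ g) ∂μ

end Average

/-! ### The two tasks

`G` is the group, `μ` its normalized Haar measure, `U` the input representation on `ℂ^a` and `V`
the output representation on `ℂ^b`. -/

section Tasks

variable {G : Type*} [MeasurableSpace G] [Group G] (μ : Measure G)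
  {a b : Type*} [Fintype a] [DecidableEq a] [Fintype b] [DecidableEq b]
  (U : G →* Matrix.unitaryGroup a ℂ) (V : G →* Matrix.unitaryGroup b ℂ)

/-- The linear representation on `ℂ^a` given by a group of unitary matrices. -/
def toRep (U : G →* Matrix.unitaryGroup a ℂ) : Representation ℂ G (a → ℂ) where
  toFun g := Matrix.toLin' (U g : Matrix a a ℂ)
  map_one' := by
    rw [map_one]
    exact Matrix.toLin'_one
  map_mul' g h := by
    rw [map_mul]
    exact Matrix.toLin'_mul _ _

/-- The output `Φ(|Φ_{U_g}⟩⟨Φ_{U_g}|)` of a Bell state conversion with the map `Φ`. -/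
def bellOutput (Φ : Matrix (a × a) (a × a) ℂ →ₗ[ℂ] Matrix (b × b) (b × b) ℂ) (g : G) :
    Matrix (b × b) (b × b) ℂ :=
  Φ (ketBra (bellVecOf (U g : Matrix a a ℂ)))

/-- The average fidelities of the conversion `|Φ_{U_g}⟩ → |Φ_{V_g}⟩` that are achieved by
deterministic machines. -/
def bellDetValues : Set ℝ :=
  {F | ∃ C : Matrix (a × a) (a × a) ℂ →ₗ[ℂ] Matrix (b × b) (b × b) ℂ, IsChannel C ∧
    F = detFidelity μ (fun g => bellVecOf (V g : Matrix b b ℂ)) (bellOutput U C)}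

/-- The average fidelities of the conversion `|Φ_{U_g}⟩ → |Φ_{V_g}⟩` that are achieved by
probabilistic machines with nonzero probability of success. -/
def bellProbValues : Set ℝ :=
  {F | ∃ M : Matrix (a × a) (a × a) ℂ →ₗ[ℂ] Matrix (b × b) (b × b) ℂ, IsQuantumOperation M ∧
    0 < totalSuccess μ (bellOutput U M) ∧
    F = probFidelity μ (fun g => bellVecOf (V g : Matrix b b ℂ)) (bellOutput U M)}

/-- `F^det_Bell[|Φ_{U_g}⟩ → |Φ_{V_g}⟩]`: the optimum over the deterministic machines. -/
def bellDetFidelity : ℝ := sSup (bellDetValues μ U V)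

/-- `F^prob_Bell[|Φ_{U_g}⟩ → |Φ_{V_g}⟩]`: the optimum over the probabilistic machines. -/
def bellProbFidelity : ℝ := sSup (bellProbValues μ U V)

/-- The network with one open slot that consists of an operation `A`, from the network's input
system to the input system of the slot and a memory, and an operation `B`, from the output system
of the slot and the memory to the network's output system. This is the map that the network
performs on its input when the gate `W` is inserted into the slot. -/
def networkMap {m : Type*} [Fintype m] [DecidableEq m]
    (A : Matrix b b ℂ →ₗ[ℂ] Matrix (a × m) (a × m) ℂ)
    (B : Matrix (a × m) (a × m) ℂ →ₗ[ℂ] Matrix b b ℂ) (W : Matrix a a ℂ) :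
    Matrix b b ℂ →ₗ[ℂ] Matrix b b ℂ :=
  B ∘ₗ conjBy (W ⊗ₖ (1 : Matrix m m ℂ)) ∘ₗ A

/-- The output `(Q_g ⊗ I)(|Φ⟩⟨Φ|)`, where `Q_g` is the map performed by the network when `U_g` is
inserted into its slot and `|Φ⟩` is the canonical Bell state of two output systems. -/
def gateOutput {m : Type*} [Fintype m] [DecidableEq m]
    (A : Matrix b b ℂ →ₗ[ℂ] Matrix (a × m) (a × m) ℂ)
    (B : Matrix (a × m) (a × m) ℂ →ₗ[ℂ] Matrix b b ℂ) (g : G) :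
    Matrix (b × b) (b × b) ℂ :=
  applyLeft b (networkMap A B (U g : Matrix a a ℂ)) (ketBra (bellVec b))

/-- The average entanglement fidelities of the gate simulation `U_g → V_g` that are achieved by
deterministic networks, with a memory of any finite dimension. -/
def gateDetValues : Set ℝ :=
  {F | ∃ (m : ℕ) (A : Matrix b b ℂ →ₗ[ℂ] Matrix (a × Fin m) (a × Fin m) ℂ)
      (B : Matrix (a × Fin m) (a × Fin m) ℂ →ₗ[ℂ] Matrix b b ℂ),
    IsChannel A ∧ IsChannel B ∧
    F = detFidelity μ (fun g => bellVecOf (V g : Matrix b b ℂ)) (gateOutput U A B)}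

/-- The average entanglement fidelities of the gate simulation `U_g → V_g` that are achieved by
probabilistic networks, with a memory of any finite dimension and with nonzero probability of
success. -/
def gateProbValues : Set ℝ :=
  {F | ∃ (m : ℕ) (A : Matrix b b ℂ →ₗ[ℂ] Matrix (a × Fin m) (a × Fin m) ℂ)
      (B : Matrix (a × Fin m) (a × Fin m) ℂ →ₗ[ℂ] Matrix b b ℂ),
    IsQuantumOperation A ∧ IsQuantumOperation B ∧
    0 < totalSuccess μ (gateOutput U A B) ∧
    F = probFidelity μ (fun g => bellVecOf (V g : Matrix b b ℂ)) (gateOutput U A B)}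

/-- `F^det_gate[U_g → V_g]`: the optimum over the deterministic networks. -/
def gateDetFidelity : ℝ := sSup (gateDetValues μ U V)

/-- `F^prob_gate[U_g → V_g]`: the optimum over the probabilistic networks. -/
def gateProbFidelity : ℝ := sSup (gateProbValues μ U V)

end Tasks

end BellConversion

end

set_option linter.unusedSectionVars false

namespace BellConversion

/-! ### Averages of matrices and of maps over a compact group -/

/-! Postselection helps only by reweighting the group elements and the inputs, and twirling removes
both effects when the representations are irreducible.

Bell states: `U_h ⊗ I` maps `|Φ_{U_g}⟩` to `|Φ_{U_{hg}}⟩`, and `I ⊗ U_kᵀ` maps it to `|Φ_{U_{gk}}⟩`.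
Averaging a completely positive `M` over both actions, undone by `V` on the output, gives an `M'`
whose overlap with the target is the same at every `g`, namely the old average, and whose success
probability is constantly `p_succ`. The functional `X ↦ Tr M'(X)` is invariant under all `U_g ⊗ I`
and `I ⊗ U_gᵀ`, so Schur's lemma makes it a multiple of the trace
(`exists_trace_of_invariant_both`). The multiple is `p_succ`, so `M'/p_succ` is a channel that
reaches the conditional fidelity of `M` exactly.

Gates: the left twirl is carried by the second operation `B`, the right twirl by the first operation
`A`. Irreducibility of `U` gives only `Tr B'(Y) = Tr((I ⊗ S)Y)` with `S` acting on the memory. If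
`S` is positive definite, `S = R†R` with `R` invertible, then composing `B'` with conjugation by `I
⊗ R⁻¹` gives a channel, and `R` is absorbed into `A` (`gateOutput_conj_memory`). Irreducibility of
`V` makes the twirled `A` trace preserving up to the factor `p_succ`, which is divided out. To make
`S` positive definite, `B` is replaced by `B + εB₀` with `B₀` a channel; letting `ε → 0` bounds
every probabilistic value by the deterministic supremum. -/

theorem continuous_applyLeft {G : Type*} [TopologicalSpace G] {s t : Type*}
    {S : G → Matrix s s ℂ →ₗ[ℂ] Matrix t t ℂ}
    (hS : ∀ X, Continuous fun g => S g X) (c : Type*) (X : Matrix (s × c) (s × c) ℂ) :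
    Continuous fun g => applyLeft c (S g) X :=
  continuous_matrix fun p q =>
    (hS (Matrix.of fun i j => X (i, p.2) (j, q.2))).matrix_elem p.1 q.1

section MatrixAverage

variable {G : Type*} [TopologicalSpace G] [CompactSpace G] [MeasurableSpace G] [BorelSpace G]
  (μ : Measure G) [IsFiniteMeasure μ] {s t : Type*}

/-- Compactness gives boundedness. Strong measurability comes from second countability of the
target, so `G` itself need not be second countable. -/
theorem integrable_of_continuous {E : Type*} [NormedAddCommGroup E]
    [SecondCountableTopology E] {f : G → E} (hf : Continuous f) : Integrable f μ := by
  let _ : MeasurableSpace E := borel E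
  have : BorelSpace E := ⟨rfl⟩
  obtain ⟨C, hC⟩ := isCompact_univ.exists_bound_of_continuousOn hf.continuousOn
  exact Integrable.of_bound hf.measurable.aestronglyMeasurable C
    (Filter.Eventually.of_forall fun x => hC x (Set.mem_univ x))

/-- The entrywise integral of a matrix valued function. -/
noncomputable def matAvg (f : G → Matrix s t ℂ) : Matrix s t ℂ :=
  Matrix.of fun i j => ∫ g, f g i j ∂μ

variable {μ}

/-- A linear functional is a finite combination of entries. Traces, quadratic forms and linear
images of averages all reduce to this. -/
theorem map_matAvg [Finite s] [Finite t] (L : Matrix s t ℂ →ₗ[ℂ] ℂ)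
    {f : G → Matrix s t ℂ} (hf : Continuous f) : L (matAvg μ f) = ∫ g, L (f g) ∂μ := by
  classical
  have := Fintype.ofFinite s
  have := Fintype.ofFinite t
  have key : ∀ X : Matrix s t ℂ, L X = ∑ i, ∑ j, X i j * L (Matrix.single i j 1) := by
    intro X
    conv_lhs => rw [Matrix.matrix_eq_sum_single X]
    simp only [map_sum]
    refine Finset.sum_congr rfl fun i _ => Finset.sum_congr rfl fun j _ => ?_
    rw [← smul_eq_mul, ← map_smul, Matrix.smul_single, smul_eq_mul, mul_one]
  have hint : ∀ i j, Integrable (fun g => f g i j * L (Matrix.single i j 1)) μ := fun i j =>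
    (integrable_of_continuous μ (hf.matrix_elem i j)).mul_const _
  rw [key]
  simp_rw [key (f _)]
  rw [integral_finsetSum _ fun i _ => integrable_finsetSum _ fun j _ => hint i j]
  refine Finset.sum_congr rfl fun i _ => ?_
  rw [integral_finsetSum _ fun j _ => hint i j]
  refine Finset.sum_congr rfl fun j _ => ?_
  rw [integral_mul_const]
  rfl

theorem linearMap_matAvg [Finite s] {t : Type*} (L : Matrix s s ℂ →ₗ[ℂ] Matrix t t ℂ)
    {f : G → Matrix s s ℂ} (hf : Continuous f) :
    L (matAvg μ f) = matAvg μ fun g => L (f g) := by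
  ext i j
  exact map_matAvg (Matrix.entryLinearMap ℂ ℂ i j ∘ₗ L) hf

theorem continuous_linearMap [Finite s] (L : Matrix s s ℂ →ₗ[ℂ] Matrix t t ℂ) [Finite t] :
    Continuous L := by
  have := Fintype.ofFinite s
  have := Fintype.ofFinite t
  exact L.continuous_of_finiteDimensional

theorem trace_matAvg [Fintype s] {f : G → Matrix s s ℂ} (hf : Continuous f) :
    (matAvg μ f).trace = ∫ g, (f g).trace ∂μ :=
  map_matAvg (Matrix.traceLinearMap s ℂ ℂ) hf

theorem dotProduct_matAvg [Fintype s] (x : s → ℂ) {f : G → Matrix s s ℂ} (hf : Continuous f) :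
    star x ⬝ᵥ (matAvg μ f *ᵥ x) = ∫ g, star x ⬝ᵥ (f g *ᵥ x) ∂μ :=
  map_matAvg
    { toFun X := star x ⬝ᵥ (X *ᵥ x)
      map_add' X Y := by rw [Matrix.add_mulVec, dotProduct_add]
      map_smul' c X := by rw [Matrix.smul_mulVec, dotProduct_smul, RingHom.id_apply] } hf

theorem integral_re_of_continuous {f : G → ℂ} (hf : Continuous f) :
    (∫ g, f g ∂μ).re = ∫ g, (f g).re ∂μ :=
  (integral_re (integrable_of_continuous μ hf)).symm

theorem reTrace_matAvg [Fintype s] {f : G → Matrix s s ℂ} (hf : Continuous f) :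
    reTrace (matAvg μ f) = ∫ g, reTrace (f g) ∂μ := by
  rw [reTrace, trace_matAvg hf]
  exact integral_re_of_continuous hf.matrix_trace

theorem overlap_matAvg [Fintype s] (x : s → ℂ) {f : G → Matrix s s ℂ} (hf : Continuous f) :
    overlap x (matAvg μ f) = ∫ g, overlap x (f g) ∂μ := by
  rw [overlap, dotProduct_matAvg x hf]
  exact integral_re_of_continuous
    (continuous_const.dotProduct (hf.matrix_mulVec continuous_const))

theorem posSemidef_matAvg [Fintype s] {f : G → Matrix s s ℂ} (hf : Continuous f)
    (hpos : ∀ g, (f g).PosSemidef) : (matAvg μ f).PosSemidef := by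
  refine Matrix.PosSemidef.of_dotProduct_mulVec_nonneg ?_ fun x => ?_
  · ext i j
    rw [Matrix.conjTranspose_apply]
    change (starRingEnd ℂ) (∫ g, f g j i ∂μ) = ∫ g, f g i j ∂μ
    rw [← integral_conj]
    refine integral_congr_ae (Filter.Eventually.of_forall fun g => ?_)
    exact (hpos g).isHermitian.apply i j
  · rw [dotProduct_matAvg x hf]
    exact integral_nonneg fun g => (hpos g).dotProduct_mulVec_nonneg x

/-- The average of a family of maps of operators. -/
noncomputable def avgMap (μ : Measure G) [IsFiniteMeasure μ]
    (S : G → Matrix s s ℂ →ₗ[ℂ] Matrix t t ℂ)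
    (hS : ∀ X, Continuous fun g => S g X) : Matrix s s ℂ →ₗ[ℂ] Matrix t t ℂ where
  toFun X := matAvg μ fun g => S g X
  map_add' X Y := by
    ext i j
    simp only [matAvg, map_add, Matrix.add_apply, Matrix.of_apply]
    exact integral_add (integrable_of_continuous μ ((hS X).matrix_elem i j))
      (integrable_of_continuous μ ((hS Y).matrix_elem i j))
  map_smul' c X := by
    ext i j
    simp only [matAvg, map_smul, Matrix.smul_apply, Matrix.of_apply, RingHom.id_apply]
    exact integral_smul c _

theorem avgMap_apply {S : G → Matrix s s ℂ →ₗ[ℂ] Matrix t t ℂ}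
    (hS : ∀ X, Continuous fun g => S g X) (X : Matrix s s ℂ) :
    avgMap μ S hS X = matAvg μ fun g => S g X := rfl

theorem applyLeft_avgMap {S : G → Matrix s s ℂ →ₗ[ℂ] Matrix t t ℂ}
    (hS : ∀ X, Continuous fun g => S g X) (c : Type*) (X : Matrix (s × c) (s × c) ℂ) :
    applyLeft c (avgMap μ S hS) X = matAvg μ fun g => applyLeft c (S g) X := rfl

theorem IsCompletelyPositive.avgMap [Fintype t] {S : G → Matrix s s ℂ →ₗ[ℂ] Matrix t t ℂ}
    (hS : ∀ X, Continuous fun g => S g X) (h : ∀ g, IsCompletelyPositive (S g)) :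
    IsCompletelyPositive (avgMap μ S hS) := fun k X hX => by
  rw [applyLeft_avgMap]
  exact posSemidef_matAvg (continuous_applyLeft hS _ X) fun g => h g k X hX

end MatrixAverage

/-- Unimodularity of a compact group: the image of `μ` under a right translation is again left
invariant of mass one. Since `μ` is not assumed regular, uniqueness of Haar measure is used for
integrals of continuous functions only. -/
theorem integral_mul_right_of_continuous {G : Type*} [Group G] [TopologicalSpace G]
    [IsTopologicalGroup G] [CompactSpace G] [MeasurableSpace G] [BorelSpace G]
    (μ : Measure G) [μ.IsHaarMeasure] [IsProbabilityMeasure μ] {f : G → ℝ}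
    (hf : Continuous f) (g : G) : ∫ x, f (x * g) ∂μ = ∫ x, f x ∂μ := by
  have : IsProbabilityMeasure (μ.map (· * g)) :=
    Measure.isProbabilityMeasure_map (measurable_mul_const g).aemeasurable
  obtain ⟨c, hc⟩ := Measure.exists_integral_isMulLeftInvariant_eq_smul_of_hasCompactSupport
    (μ.map (· * g)) μ
  have h1 := hc (fun _ => 1) continuous_const (.of_compactSpace _)
  have h2 := hc f hf (.of_compactSpace _)
  rw [integral_map (measurable_mul_const g).aemeasurable
    hf.measurable.aestronglyMeasurable] at h2
  rw [integral_smul_nnreal_measure] at h1 h2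
  have hc1 : c = 1 := by
    rw [integral_const, integral_const] at h1
    simpa [NNReal.smul_def] using h1.symm
  rw [h2, hc1, one_smul]

theorem integral_mul_right_of_continuous_complex {G : Type*} [Group G] [TopologicalSpace G]
    [IsTopologicalGroup G] [CompactSpace G] [MeasurableSpace G] [BorelSpace G]
    (μ : Measure G) [μ.IsHaarMeasure] [IsProbabilityMeasure μ] {f : G → ℂ}
    (hf : Continuous f) (g : G) : ∫ x, f (x * g) ∂μ = ∫ x, f x ∂μ := by
  have hfg : Continuous fun x => f (x * g) := hf.comp (continuous_mul_const g)
  apply Complex.ext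
  · rw [integral_re_of_continuous hf, integral_re_of_continuous hfg]
    exact integral_mul_right_of_continuous μ (Complex.continuous_re.comp hf) g
  · have him : ∀ F : G → ℂ, Continuous F → (∫ x, F x ∂μ).im = ∫ x, (F x).im ∂μ := fun F hF =>
      (integral_im (integrable_of_continuous μ hF)).symm
    rw [him _ hf, him _ hfg]
    exact integral_mul_right_of_continuous μ (Complex.continuous_im.comp hf) g

/-! ### Schur's lemma and invariant functionals -/

section Schur

variable {G : Type*} [Group G] {a : Type*} [Fintype a] [DecidableEq a]
  {U : G →* Matrix.unitaryGroup a ℂ}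

theorem nonempty_of_isIrreducible (h : (toRep U).IsIrreducible) : Nonempty a := by
  by_contra hne
  rw [not_nonempty_iff] at hne
  obtain ⟨x, y, hxy⟩ := h.toNontrivial
  refine hxy (SetLike.ext fun v => ?_)
  rw [Subsingleton.elim v 0]
  exact ⟨fun _ => y.toSubmodule.zero_mem, fun _ => x.toSubmodule.zero_mem⟩

/-- Schur's lemma for irreducible groups of unitary matrices. -/
theorem exists_eq_smul_one_of_commute (h : (toRep U).IsIrreducible) {T : Matrix a a ℂ}
    (hT : ∀ g, T * (U g : Matrix a a ℂ) = (U g : Matrix a a ℂ) * T) :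
    ∃ c : ℂ, T = c • (1 : Matrix a a ℂ) := by
  let f : Representation.IntertwiningMap (toRep U) (toRep U) :=
    { Matrix.toLin' T with
      isIntertwining' := fun g => by
        change Matrix.toLin' T ∘ₗ Matrix.toLin' _ = Matrix.toLin' _ ∘ₗ Matrix.toLin' T
        rw [← Matrix.toLin'_mul, ← Matrix.toLin'_mul, hT] }
  obtain ⟨c, hc⟩ :=
    (Representation.IsIrreducible.algebraMap_intertwiningMap_bijective_of_isAlgClosed
      (ρ := toRep U)).surjective f
  refine ⟨c, Matrix.toLin'.injective ?_⟩
  rw [map_smul, Matrix.toLin'_one]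
  exact (congrArg Representation.IntertwiningMap.toLinearMap hc).symm

end Schur

section Functionals

variable {s : Type*} [Fintype s] [DecidableEq s]

theorem exists_eq_trace_mul (τ : Matrix s s ℂ →ₗ[ℂ] ℂ) :
    ∃ S : Matrix s s ℂ, ∀ X, τ X = (S * X).trace := by
  -- The indices are swapped because `Tr(SX) = ∑ S i j * X j i`.
  refine ⟨Matrix.of fun i j => τ (Matrix.single j i 1), fun X => ?_⟩
  conv_lhs => rw [Matrix.matrix_eq_sum_single X]
  simp only [map_sum, Matrix.trace, Matrix.diag_apply, Matrix.mul_apply, Matrix.of_apply]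
  rw [Finset.sum_comm]
  refine Finset.sum_congr rfl fun i _ => Finset.sum_congr rfl fun j _ => ?_
  rw [mul_comm, ← smul_eq_mul, ← map_smul, Matrix.smul_single, smul_eq_mul, mul_one]

/-- By cyclicity the hypothesis reads `Tr(P†SP X) = Tr(S X)` for all `X`, and the trace pairing is
nondegenerate. -/
theorem commute_of_trace_conj_eq {S P : Matrix s s ℂ} (hP : P ∈ Matrix.unitaryGroup s ℂ)
    (h : ∀ X, (S * (P * X * Pᴴ)).trace = (S * X).trace) : S * P = P * S := by
  have hS : Pᴴ * S * P = S := by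
    rw [Matrix.ext_iff_trace_mul_right]
    intro X
    rw [← h X, mul_assoc, mul_assoc, Matrix.trace_mul_comm]
    simp only [mul_assoc]
  have hPP : P * Pᴴ = 1 := Matrix.mem_unitaryGroup_iff.1 hP
  conv_rhs => rw [← hS]
  rw [← mul_assoc, ← mul_assoc, hPP, one_mul]

variable {G : Type*} [Group G] {a m : Type*} [Fintype a] [DecidableEq a] [Fintype m]
  [DecidableEq m] {U : G →* Matrix.unitaryGroup a ℂ}

theorem exists_trace_of_invariant (h : (toRep U).IsIrreducible) (τ : Matrix a a ℂ →ₗ[ℂ] ℂ)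
    (hτ : ∀ g X, τ ((U g : Matrix a a ℂ) * X * (U g : Matrix a a ℂ)ᴴ) = τ X) :
    ∃ c : ℂ, ∀ X, τ X = c * X.trace := by
  obtain ⟨S, hS⟩ := exists_eq_trace_mul τ
  obtain ⟨c, hc⟩ := exists_eq_smul_one_of_commute h (T := S) fun g =>
    commute_of_trace_conj_eq (U g).2 fun X => by rw [← hS, ← hS, hτ]
  refine ⟨c, fun X => ?_⟩
  rw [hS, hc, Matrix.smul_mul, one_mul, Matrix.trace_smul, smul_eq_mul]

theorem kronecker_one_mem_unitaryGroup {W : Matrix a a ℂ} (hW : W ∈ Matrix.unitaryGroup a ℂ) :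
    W ⊗ₖ (1 : Matrix m m ℂ) ∈ Matrix.unitaryGroup (a × m) ℂ := by
  rw [Matrix.mem_unitaryGroup_iff, Matrix.star_eq_conjTranspose, Matrix.conjTranspose_kronecker,
    ← Matrix.mul_kronecker_mul, Matrix.conjTranspose_one, ← Matrix.star_eq_conjTranspose,
    Matrix.mem_unitaryGroup_iff.1 hW, one_mul, Matrix.one_kronecker_one]

theorem one_kronecker_mem_unitaryGroup {W : Matrix a a ℂ} (hW : W ∈ Matrix.unitaryGroup a ℂ) :
    (1 : Matrix m m ℂ) ⊗ₖ W ∈ Matrix.unitaryGroup (m × a) ℂ := by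
  rw [Matrix.mem_unitaryGroup_iff, Matrix.star_eq_conjTranspose, Matrix.conjTranspose_kronecker,
    ← Matrix.mul_kronecker_mul, Matrix.conjTranspose_one, ← Matrix.star_eq_conjTranspose,
    Matrix.mem_unitaryGroup_iff.1 hW, one_mul, Matrix.one_kronecker_one]

theorem transpose_mem_unitaryGroup {W : Matrix a a ℂ} (hW : W ∈ Matrix.unitaryGroup a ℂ) :
    Wᵀ ∈ Matrix.unitaryGroup a ℂ := by
  rw [Matrix.mem_unitaryGroup_iff]
  have h := Matrix.mem_unitaryGroup_iff'.1 hW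
  rw [Matrix.star_eq_conjTranspose] at h ⊢
  rw [← Matrix.transpose_one, ← h, Matrix.transpose_mul]
  rfl

theorem conjTranspose_mem_unitaryGroup {W : Matrix a a ℂ} (hW : W ∈ Matrix.unitaryGroup a ℂ) :
    Wᴴ ∈ Matrix.unitaryGroup a ℂ := by
  rw [Matrix.mem_unitaryGroup_iff, Matrix.star_eq_conjTranspose, Matrix.conjTranspose_conjTranspose]
  exact Matrix.mem_unitaryGroup_iff'.1 hW

/-- A functional that is invariant under an irreducible group of unitaries on the first factor of a
tensor product only depends on the partial trace over that factor. -/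
theorem exists_trace_of_invariant_left (h : (toRep U).IsIrreducible)
    (τ : Matrix (a × m) (a × m) ℂ →ₗ[ℂ] ℂ)
    (hτ : ∀ g X, τ ((U g : Matrix a a ℂ) ⊗ₖ (1 : Matrix m m ℂ) * X *
      ((U g : Matrix a a ℂ) ⊗ₖ (1 : Matrix m m ℂ))ᴴ) = τ X) :
    ∃ T : Matrix m m ℂ, ∀ X, τ X = ((1 : Matrix a a ℂ) ⊗ₖ T * X).trace := by
  obtain ⟨S, hS⟩ := exists_eq_trace_mul τ
  -- `S` commutes with `U_g ⊗ I`, so each of its blocks indexed by the second factor commutes with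
  -- `U_g` and is scalar; these scalars are the entries of `T`.
  have hblock : ∀ p q : m, ∃ c : ℂ,
      (Matrix.of fun i j => S (i, p) (j, q)) = c • (1 : Matrix a a ℂ) := by
    intro p q
    refine exists_eq_smul_one_of_commute h fun g => ?_
    have hcomm := commute_of_trace_conj_eq (S := S)
      (kronecker_one_mem_unitaryGroup (m := m) (U g).2) fun X => by rw [← hS, ← hS, hτ]
    ext i j
    have hij := congrFun (congrFun hcomm (i, p)) (j, q)
    simpa [Matrix.mul_apply, Fintype.sum_prod_type, Matrix.one_apply, Matrix.kroneckerMap_apply]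
      using hij
  choose T hT using hblock
  refine ⟨Matrix.of T, fun X => ?_⟩
  rw [hS]
  congr 2
  ext ⟨i, p⟩ ⟨j, q⟩
  have := congrFun (congrFun (hT p q) i) j
  simpa [mul_comm] using this

/-- A functional that is invariant under an irreducible group of unitaries on the first factor and
under the group of its transposes on the second one is a multiple of the trace. -/
theorem exists_trace_of_invariant_both (h : (toRep U).IsIrreducible)
    (τ : Matrix (a × a) (a × a) ℂ →ₗ[ℂ] ℂ)
    (hleft : ∀ g X, τ ((U g : Matrix a a ℂ) ⊗ₖ (1 : Matrix a a ℂ) * X *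
      ((U g : Matrix a a ℂ) ⊗ₖ (1 : Matrix a a ℂ))ᴴ) = τ X)
    (hright : ∀ g X, τ ((1 : Matrix a a ℂ) ⊗ₖ (U g : Matrix a a ℂ)ᵀ * X *
      ((1 : Matrix a a ℂ) ⊗ₖ (U g : Matrix a a ℂ)ᵀ)ᴴ) = τ X) :
    ∃ c : ℂ, ∀ X, τ X = c * X.trace := by
  obtain ⟨T, hT⟩ := exists_trace_of_invariant_left h τ hleft
  obtain ⟨e⟩ := nonempty_of_isIrreducible h
  -- The second invariance makes `T` commute with `U_gᵀ`; Schur's lemma for `U` itself therefore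
  -- applies to `Tᵀ`.
  obtain ⟨c, hc⟩ := exists_eq_smul_one_of_commute h (T := Tᵀ) fun g => by
    rw [← Matrix.transpose_inj, Matrix.transpose_mul, Matrix.transpose_mul,
      Matrix.transpose_transpose]
    refine (commute_of_trace_conj_eq (transpose_mem_unitaryGroup (U g).2) fun Y => ?_).symm
    -- A first factor of trace one isolates `T` in the second factor.
    have hY := hright g (Matrix.single e e 1 ⊗ₖ Y)
    rw [hT, hT, Matrix.conjTranspose_kronecker, Matrix.conjTranspose_one,
      ← Matrix.mul_kronecker_mul, ← Matrix.mul_kronecker_mul, ← Matrix.mul_kronecker_mul,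
      ← Matrix.mul_kronecker_mul, one_mul, mul_one, one_mul, Matrix.trace_kronecker,
      Matrix.trace_kronecker, Matrix.trace_single_eq_same, one_mul, one_mul] at hY
    exact hY
  refine ⟨c, fun X => ?_⟩
  have hc' : T = c • (1 : Matrix a a ℂ) := by
    rw [← Matrix.transpose_inj, hc, Matrix.transpose_smul, Matrix.transpose_one]
  rw [hT, hc', Matrix.kronecker_smul, Matrix.one_kronecker_one, Matrix.smul_mul, one_mul,
    Matrix.trace_smul, smul_eq_mul]

end Functionals

/-! ### Completely positive maps -/

section CompletelyPositive

variable {s t u c : Type*}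

theorem applyLeft_comp (c : Type*) (Ψ : Matrix t t ℂ →ₗ[ℂ] Matrix u u ℂ)
    (Φ : Matrix s s ℂ →ₗ[ℂ] Matrix t t ℂ) (X : Matrix (s × c) (s × c) ℂ) :
    applyLeft c (Ψ ∘ₗ Φ) X = applyLeft c Ψ (applyLeft c Φ X) := rfl

theorem IsCompletelyPositive.comp {Ψ : Matrix t t ℂ →ₗ[ℂ] Matrix u u ℂ}
    {Φ : Matrix s s ℂ →ₗ[ℂ] Matrix t t ℂ} (hΨ : IsCompletelyPositive Ψ)
    (hΦ : IsCompletelyPositive Φ) : IsCompletelyPositive (Ψ ∘ₗ Φ) := fun k X hX => by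
  rw [applyLeft_comp]
  exact hΨ k _ (hΦ k X hX)

theorem IsCompletelyPositive.add {Φ Ψ : Matrix s s ℂ →ₗ[ℂ] Matrix t t ℂ}
    (hΦ : IsCompletelyPositive Φ) (hΨ : IsCompletelyPositive Ψ) :
    IsCompletelyPositive (Φ + Ψ) := fun k X hX => (hΦ k X hX).add (hΨ k X hX)

theorem IsCompletelyPositive.smul {Φ : Matrix s s ℂ →ₗ[ℂ] Matrix t t ℂ}
    (hΦ : IsCompletelyPositive Φ) {r : ℝ} (hr : 0 ≤ r) :
    IsCompletelyPositive (r • Φ) := fun k X hX => (hΦ k X hX).smul hr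

/-- The ancilla is relabelled by some `Fin k`, as in the definition of complete positivity. -/
theorem IsCompletelyPositive.posSemidef_applyLeft [Fintype c]
    {Φ : Matrix s s ℂ →ₗ[ℂ] Matrix t t ℂ} (hΦ : IsCompletelyPositive Φ)
    {X : Matrix (s × c) (s × c) ℂ} (hX : X.PosSemidef) : (applyLeft c Φ X).PosSemidef := by
  let e := Fintype.equivFin c
  exact (hΦ _ _ (hX.submatrix (Prod.map id e.symm))).submatrix (Prod.map id e) |> fun h => by
    convert h using 1
    ext p q
    simp [applyLeft]

theorem IsCompletelyPositive.posSemidef_map {Φ : Matrix s s ℂ →ₗ[ℂ] Matrix t t ℂ}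
    (hΦ : IsCompletelyPositive Φ) {X : Matrix s s ℂ} (hX : X.PosSemidef) :
    (Φ X).PosSemidef :=
  (hΦ.posSemidef_applyLeft (c := Unit) (hX.submatrix Prod.fst)).submatrix fun i => (i, ())

theorem conjBy_apply [Fintype s] (W X : Matrix s s ℂ) : conjBy W X = W * X * Wᴴ := rfl

theorem conjBy_comp_conjBy [Fintype s] (W W' : Matrix s s ℂ) :
    conjBy W ∘ₗ conjBy W' = conjBy (W * W') := by
  ext1 X
  simp [conjBy_apply, mul_assoc]

theorem conjBy_conjBy [Fintype s] (W W' X : Matrix s s ℂ) :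
    conjBy W (conjBy W' X) = conjBy (W * W') X := by
  rw [← conjBy_comp_conjBy, LinearMap.comp_apply]

theorem trace_conjBy [Fintype s] [DecidableEq s] {W : Matrix s s ℂ}
    (hW : W ∈ Matrix.unitaryGroup s ℂ) (X : Matrix s s ℂ) : (conjBy W X).trace = X.trace := by
  rw [conjBy_apply, mul_assoc, Matrix.trace_mul_comm, mul_assoc, ← Matrix.star_eq_conjTranspose,
    Matrix.mem_unitaryGroup_iff'.1 hW, mul_one]

theorem applyLeft_conjBy [Fintype s] [Fintype c] [DecidableEq c] (W : Matrix s s ℂ)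
    (X : Matrix (s × c) (s × c) ℂ) :
    applyLeft c (conjBy W) X = conjBy (W ⊗ₖ (1 : Matrix c c ℂ)) X := by
  ext ⟨i, p⟩ ⟨j, q⟩
  simp [applyLeft, conjBy_apply, Matrix.mul_apply, Fintype.sum_prod_type, Matrix.one_apply,
    Matrix.kroneckerMap_apply, apply_ite (starRingEnd ℂ)]

theorem isCompletelyPositive_conjBy [Fintype s] (W : Matrix s s ℂ) :
    IsCompletelyPositive (conjBy W) := fun k X hX => by
  rw [applyLeft_conjBy, conjBy_apply]
  exact hX.mul_mul_conjTranspose_same _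

theorem conjBy_one_kronecker_apply [Fintype s] [DecidableEq s] [Fintype c] (K : Matrix c c ℂ)
    (X : Matrix (s × c) (s × c) ℂ) (i j : s) (p q : c) :
    conjBy ((1 : Matrix s s ℂ) ⊗ₖ K) X (i, p) (j, q) =
      ∑ r, ∑ r', K p r' * X (i, r') (j, r) * star (K q r) := by
  simp [conjBy_apply, Matrix.mul_apply, Fintype.sum_prod_type, Matrix.one_apply,
    Matrix.kroneckerMap_apply, apply_ite (starRingEnd ℂ), Finset.sum_mul]

/-- `K` only forms linear combinations of the blocks on which `Φ` acts, so linearity of `Φ`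
suffices. -/
theorem applyLeft_conjBy_one_kronecker [Fintype s] [DecidableEq s] [Fintype t] [DecidableEq t]
    [Fintype c] (Φ : Matrix s s ℂ →ₗ[ℂ] Matrix t t ℂ) (K : Matrix c c ℂ)
    (X : Matrix (s × c) (s × c) ℂ) :
    applyLeft c Φ (conjBy ((1 : Matrix s s ℂ) ⊗ₖ K) X) =
      conjBy ((1 : Matrix t t ℂ) ⊗ₖ K) (applyLeft c Φ X) := by
  have hblock : ∀ p q : c,
      (Matrix.of fun i j => conjBy ((1 : Matrix s s ℂ) ⊗ₖ K) X (i, p) (j, q)) =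
        ∑ r, ∑ r', (K p r' * star (K q r)) • (Matrix.of fun i j => X (i, r') (j, r)) := by
    intro p q
    ext i j
    rw [Matrix.of_apply, conjBy_one_kronecker_apply]
    simp only [Matrix.sum_apply, Matrix.smul_apply, Matrix.of_apply, smul_eq_mul, mul_right_comm]
  ext ⟨i, p⟩ ⟨j, q⟩
  rw [applyLeft, Matrix.of_apply, hblock, conjBy_one_kronecker_apply]
  simp only [map_sum, map_smul, Matrix.sum_apply, Matrix.smul_apply, smul_eq_mul]
  exact Finset.sum_congr rfl fun r _ => Finset.sum_congr rfl fun r' _ => mul_right_comm _ _ _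

theorem trace_applyLeft [Fintype s] [Fintype t] [Fintype c]
    {Φ : Matrix s s ℂ →ₗ[ℂ] Matrix t t ℂ} {r : ℂ} (hΦ : ∀ X, (Φ X).trace = r * X.trace)
    (X : Matrix (s × c) (s × c) ℂ) : (applyLeft c Φ X).trace = r * X.trace := by
  simp only [Matrix.trace, Matrix.diag_apply, Fintype.sum_prod_type_right] at hΦ ⊢
  rw [Finset.mul_sum]
  exact Finset.sum_congr rfl fun p _ => hΦ (Matrix.of fun i j => X (i, p) (j, p))

/-- The map that discards its input and prepares the operator `ρ`. -/
noncomputable def prepare (s : Type*) [Fintype s] (ρ : Matrix t t ℂ) :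
    Matrix s s ℂ →ₗ[ℂ] Matrix t t ℂ :=
  (Matrix.traceLinearMap s ℂ ℂ).smulRight ρ

theorem prepare_apply [Fintype s] (ρ : Matrix t t ℂ) (X : Matrix s s ℂ) :
    prepare s ρ X = X.trace • ρ := rfl

theorem isCompletelyPositive_prepare [Fintype s] [Fintype t] {ρ : Matrix t t ℂ}
    (hρ : ρ.PosSemidef) : IsCompletelyPositive (prepare s ρ) := fun k X hX => by
  -- The output is `ρ` tensored with the partial trace of `X`, a sum of principal submatrices of
  -- `X`.
  have h : applyLeft (Fin k) (prepare s ρ) X =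
      ρ ⊗ₖ (∑ i, X.submatrix (fun p => (i, p)) fun p => (i, p)) := by
    ext ⟨i, p⟩ ⟨j, q⟩
    simp [applyLeft, prepare_apply, Matrix.trace, Matrix.kroneckerMap_apply, Matrix.sum_apply,
      mul_comm]
  rw [h]
  exact hρ.kronecker (Matrix.posSemidef_sum _ fun i _ => hX.submatrix _)

theorem posSemidef_single [DecidableEq t] [Fintype t] (e : t) :
    (Matrix.single e e (1 : ℂ)).PosSemidef := by
  have h := Matrix.posSemidef_vecMulVec_self_star (Pi.single e (1 : ℂ) : t → ℂ)
  convert h using 1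
  ext i j
  by_cases hi : i = e <;> by_cases hj : j = e <;>
    simp [Matrix.vecMulVec_apply, hi, hj, Ne.symm]

theorem isChannel_prepare_single [Fintype s] [Fintype t] [DecidableEq t] (e : t) :
    IsChannel (prepare s (Matrix.single e e (1 : ℂ))) where
  completelyPositive := isCompletelyPositive_prepare (posSemidef_single e)
  trace_map X := by
    rw [prepare_apply, Matrix.trace_smul, Matrix.trace_single_eq_same, smul_eq_mul, mul_one]

theorem IsChannel.isQuantumOperation [Fintype s] [Fintype t]
    {Φ : Matrix s s ℂ →ₗ[ℂ] Matrix t t ℂ} (h : IsChannel Φ) : IsQuantumOperation Φ where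
  completelyPositive := h.completelyPositive
  trace_map_le X _ := by rw [reTrace, reTrace, h.trace_map]

end CompletelyPositive

/-! ### Overlaps and Bell states -/

section Overlap

variable {s : Type*} [Fintype s]

theorem overlap_smul (ψ : s → ℂ) (r : ℝ) (σ : Matrix s s ℂ) :
    overlap ψ (r • σ) = r * overlap ψ σ := by
  rw [overlap, overlap, Matrix.smul_mulVec, dotProduct_smul, Complex.smul_re, smul_eq_mul]

theorem overlap_add (ψ : s → ℂ) (σ ρ : Matrix s s ℂ) :
    overlap ψ (σ + ρ) = overlap ψ σ + overlap ψ ρ := by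
  rw [overlap, Matrix.add_mulVec, dotProduct_add, Complex.add_re, overlap, overlap]

theorem reTrace_smul (r : ℝ) (σ : Matrix s s ℂ) : reTrace (r • σ) = r * reTrace σ := by
  rw [reTrace, reTrace, Matrix.trace_smul, Complex.smul_re, smul_eq_mul]

theorem reTrace_add (σ ρ : Matrix s s ℂ) : reTrace (σ + ρ) = reTrace σ + reTrace ρ := by
  rw [reTrace, Matrix.trace_add, Complex.add_re, reTrace, reTrace]

theorem overlap_conjBy_conjTranspose (W : Matrix s s ℂ) (ψ : s → ℂ) (σ : Matrix s s ℂ) :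
    overlap ψ (conjBy Wᴴ σ) = overlap (W *ᵥ ψ) σ := by
  rw [overlap, overlap, conjBy_apply, Matrix.conjTranspose_conjTranspose, Matrix.star_mulVec,
    ← Matrix.dotProduct_mulVec, Matrix.mulVec_mulVec, Matrix.mulVec_mulVec, mul_assoc]

theorem conjBy_ketBra (W : Matrix s s ℂ) (ψ : s → ℂ) :
    conjBy W (ketBra ψ) = ketBra (W *ᵥ ψ) := by
  rw [conjBy_apply, ketBra, ketBra, Matrix.mul_vecMulVec, Matrix.vecMulVec_mul, Matrix.star_mulVec]

theorem posSemidef_ketBra (ψ : s → ℂ) : (ketBra ψ).PosSemidef :=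
  Matrix.posSemidef_vecMulVec_self_star ψ

theorem trace_ketBra (ψ : s → ℂ) : (ketBra ψ).trace = star ψ ⬝ᵥ ψ := by
  rw [ketBra, Matrix.trace_vecMulVec, dotProduct_comm]

theorem reTrace_nonneg {σ : Matrix s s ℂ} (hσ : σ.PosSemidef) : 0 ≤ reTrace σ :=
  (Complex.nonneg_iff.1 hσ.trace_nonneg).1

theorem eq_reTrace_of_trace_eq {σ : Matrix s s ℂ} (hσ : σ.PosSemidef)
    {c : ℂ} (h : σ.trace = c) : c = (reTrace σ : ℂ) := by
  subst h
  exact Complex.ext rfl (Complex.nonneg_iff.1 hσ.trace_nonneg).2.symm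

theorem overlap_nonneg {σ : Matrix s s ℂ} (hσ : σ.PosSemidef) (ψ : s → ℂ) : 0 ≤ overlap ψ σ :=
  (Complex.nonneg_iff.1 (hσ.dotProduct_mulVec_nonneg ψ)).1

/-- With the projection `Q = 1 - |ψ⟩⟨ψ|`, the difference of the two sides is `Tr(QσQ†) ≥ 0`. -/
theorem overlap_le_reTrace [DecidableEq s] {σ : Matrix s s ℂ} (hσ : σ.PosSemidef) {ψ : s → ℂ}
    (hψ : star ψ ⬝ᵥ ψ = 1) : overlap ψ σ ≤ reTrace σ := by
  have hP : ketBra ψ * ketBra ψ = ketBra ψ := by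
    rw [ketBra, Matrix.vecMulVec_mul_vecMulVec, hψ, one_smul]
  have hPH : (ketBra ψ)ᴴ = ketBra ψ := (posSemidef_ketBra ψ).isHermitian
  have htr : (σ * ketBra ψ).trace = star ψ ⬝ᵥ (σ *ᵥ ψ) := by
    rw [ketBra, Matrix.mul_vecMulVec, Matrix.trace_vecMulVec, dotProduct_comm]
  have hQ : (1 - ketBra ψ) * (1 - ketBra ψ) = 1 - ketBra ψ := by
    rw [sub_mul, one_mul, mul_sub, mul_one, hP, sub_self, sub_zero]
  have h := reTrace_nonneg (hσ.mul_mul_conjTranspose_same (1 - ketBra ψ))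
  have h' : ((1 - ketBra ψ) * σ * (1 - ketBra ψ)ᴴ).trace = σ.trace - star ψ ⬝ᵥ (σ *ᵥ ψ) := by
    rw [Matrix.conjTranspose_sub, hPH, Matrix.conjTranspose_one, mul_assoc, Matrix.trace_mul_comm,
      mul_assoc, hQ, mul_sub, mul_one, Matrix.trace_sub, htr]
  rw [reTrace, h', Complex.sub_re] at h
  exact sub_nonneg.1 h

variable [DecidableEq s]

theorem bellVecOf_apply (W : Matrix s s ℂ) (p : s × s) :
    bellVecOf W p = W p.1 p.2 * (((Real.sqrt (Fintype.card s))⁻¹ : ℝ) : ℂ) := by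
  simp [bellVecOf, bellVec, Matrix.mulVec, dotProduct, Fintype.sum_prod_type, Matrix.one_apply,
    Matrix.kroneckerMap_apply]

theorem bellVecOf_one : bellVecOf (1 : Matrix s s ℂ) = bellVec s := by
  rw [bellVecOf, Matrix.one_kronecker_one, Matrix.one_mulVec]

theorem kronecker_one_mulVec_bellVecOf (W W' : Matrix s s ℂ) :
    (W ⊗ₖ (1 : Matrix s s ℂ)) *ᵥ bellVecOf W' = bellVecOf (W * W') := by
  rw [bellVecOf, bellVecOf, Matrix.mulVec_mulVec, ← Matrix.mul_kronecker_mul, one_mul]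

/-- The transpose trick: an operator on the second half of a Bell state acts as right
multiplication, so right translations of the group become local unitaries. -/
theorem one_kronecker_transpose_mulVec_bellVecOf (W W' : Matrix s s ℂ) :
    ((1 : Matrix s s ℂ) ⊗ₖ Wᵀ) *ᵥ bellVecOf W' = bellVecOf (W' * W) := by
  ext ⟨i, j⟩
  simp [bellVecOf_apply, Matrix.mulVec, dotProduct, Fintype.sum_prod_type, Matrix.one_apply,
    Matrix.kroneckerMap_apply, Matrix.mul_apply, Finset.sum_mul]
  exact Finset.sum_congr rfl fun _ _ => by ring

theorem star_bellVecOf_dotProduct_self [Nonempty s] {W : Matrix s s ℂ}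
    (hW : W ∈ Matrix.unitaryGroup s ℂ) : star (bellVecOf W) ⬝ᵥ bellVecOf W = 1 := by
  rw [bellVecOf, Matrix.star_mulVec, ← Matrix.dotProduct_mulVec, Matrix.mulVec_mulVec,
    ← Matrix.star_eq_conjTranspose,
    Matrix.mem_unitaryGroup_iff'.1 (kronecker_one_mem_unitaryGroup hW), Matrix.one_mulVec]
  have hc : (0 : ℝ) < Fintype.card s := Nat.cast_pos.2 Fintype.card_pos
  have h2 : (((Real.sqrt (Fintype.card s))⁻¹ : ℝ) : ℂ) * (((Real.sqrt (Fintype.card s))⁻¹ : ℝ) : ℂ)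
      = ((Fintype.card s : ℝ) : ℂ)⁻¹ := by
    rw [← Complex.ofReal_mul, ← mul_inv, Real.mul_self_sqrt hc.le, Complex.ofReal_inv]
  simp only [dotProduct, Pi.star_apply, bellVec, Fintype.sum_prod_type, RCLike.star_def]
  simp only [apply_ite (starRingEnd ℂ), map_zero, Complex.conj_ofReal, ite_mul, mul_ite, zero_mul,
    mul_zero, h2]
  simp

end Overlap

/-! ### Average fidelities -/

section Fidelity

variable {G : Type*} [MeasurableSpace G] {μ : Measure G} {s : Type*} [Fintype s]

/-- The weight `Tr σ_g` cancels the normalization of the output state, leaving a ratio of two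
integrals linear in `σ`. -/
theorem probFidelity_eq_div (ψ : G → s → ℂ) {σ : G → Matrix s s ℂ}
    (hσ : ∀ g, (σ g).PosSemidef) :
    probFidelity μ ψ σ = (∫ g, overlap (ψ g) (σ g) ∂μ) / totalSuccess μ σ := by
  rw [probFidelity, ← integral_div]
  refine integral_congr_ae (Filter.Eventually.of_forall fun g => ?_)
  change reTrace (σ g) / _ * overlap (ψ g) ((reTrace (σ g))⁻¹ • σ g) = _
  rw [overlap_smul]
  -- A positive operator of trace zero vanishes, so the default value of the inverse at zero does no
  -- harm.
  by_cases h : reTrace (σ g) = 0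
  · have h0 : σ g = 0 := by
      rw [← (hσ g).trace_eq_zero_iff]
      exact Complex.ext h (Complex.nonneg_iff.1 (hσ g).trace_nonneg).2.symm
    simp [h0, overlap, reTrace]
  · field_simp

variable [IsProbabilityMeasure μ]

theorem totalSuccess_eq_one {σ : G → Matrix s s ℂ} (h : ∀ g, (σ g).trace = 1) :
    totalSuccess μ σ = 1 := by
  simp [totalSuccess, reTrace, h]

theorem detFidelity_le_one [DecidableEq s] {ψ : G → s → ℂ} (hψ : ∀ g, star (ψ g) ⬝ᵥ ψ g = 1)
    {σ : G → Matrix s s ℂ} (hσ : ∀ g, (σ g).PosSemidef) (h : ∀ g, (σ g).trace = 1) :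
    detFidelity μ ψ σ ≤ 1 := by
  have hb : ∀ g, ‖overlap (ψ g) (σ g)‖ ≤ 1 := fun g => by
    rw [Real.norm_of_nonneg (overlap_nonneg (hσ g) _)]
    refine (overlap_le_reTrace (hσ g) (hψ g)).trans_eq ?_
    rw [reTrace, h, Complex.one_re]
  have := norm_integral_le_of_norm_le_const (μ := μ) (Filter.Eventually.of_forall hb)
  rw [probReal_univ, mul_one] at this
  exact (le_abs_self _).trans this

/-- The `IsLUB` claims certify that neither `sSup` is the default value for an empty or unbounded
set. -/
theorem isLUB_sSup_and_eq {D P : Set ℝ} (hsub : D ⊆ P) (hne : D.Nonempty) (hbdd : BddAbove D)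
    (hP : ∀ F ∈ P, F ≤ sSup D) :
    IsLUB D (sSup D) ∧ IsLUB P (sSup P) ∧ sSup D = sSup P := by
  have h1 := isLUB_csSup hne hbdd
  have h2 : IsLUB P (sSup D) := ⟨hP, fun B hB => h1.2 fun F hF => hB (hsub hF)⟩
  have h3 := h2.csSup_eq (hne.mono hsub)
  exact ⟨h1, h3.symm ▸ h2, h3.symm⟩

end Fidelity

/-! ### Continuity in the group element. -/

section Continuity

variable {G : Type*} [TopologicalSpace G] {s t c : Type*}

theorem continuous_conjBy [Fintype s] {W X : G → Matrix s s ℂ} (hW : Continuous W)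
    (hX : Continuous X) : Continuous fun g => conjBy (W g) (X g) :=
  (hW.matrix_mul hX).matrix_mul hW.matrix_conjTranspose

theorem continuous_kronecker {W : G → Matrix s s ℂ} {W' : G → Matrix t t ℂ}
    (hW : Continuous W) (hW' : Continuous W') : Continuous fun g => W g ⊗ₖ W' g :=
  continuous_matrix fun p q => (hW.matrix_elem p.1 q.1).mul (hW'.matrix_elem p.2 q.2)

theorem continuous_kronecker_one [DecidableEq c] {W : G → Matrix s s ℂ} (hW : Continuous W) :
    Continuous fun g => W g ⊗ₖ (1 : Matrix c c ℂ) :=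
  continuous_kronecker hW continuous_const

theorem continuous_one_kronecker_transpose [DecidableEq c] {W : G → Matrix s s ℂ}
    (hW : Continuous W) : Continuous fun g => (1 : Matrix c c ℂ) ⊗ₖ (W g)ᵀ :=
  continuous_kronecker continuous_const hW.matrix_transpose

theorem continuous_ketBra_bellVecOf [Fintype s] [DecidableEq s] {W : G → Matrix s s ℂ}
    (hW : Continuous W) : Continuous fun g => ketBra (bellVecOf (W g)) := by
  have h : Continuous fun g => bellVecOf (W g) :=
    (continuous_kronecker_one hW).matrix_mulVec continuous_const
  exact h.matrix_vecMulVec h.star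

theorem continuous_comp_comp_conjBy [Fintype s] [Fintype t] {W : G → Matrix s s ℂ}
    {W' : G → Matrix t t ℂ} (hW : Continuous W) (hW' : Continuous W')
    (M : Matrix s s ℂ →ₗ[ℂ] Matrix t t ℂ) (X : Matrix s s ℂ) :
    Continuous fun g => (conjBy (W' g) ∘ₗ M ∘ₗ conjBy (W g)) X :=
  continuous_conjBy hW' ((continuous_linearMap M).comp (continuous_conjBy hW continuous_const))

theorem continuous_coe_unitary [Group G] [Fintype s] [DecidableEq s]
    {V : G →* Matrix.unitaryGroup s ℂ} (hV : Continuous V) : Continuous fun g => (V g : Matrix s s ℂ) :=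
  continuous_subtype_val.comp hV

theorem continuous_reTrace [Fintype s] {σ : G → Matrix s s ℂ} (hσ : Continuous σ) :
    Continuous fun g => reTrace (σ g) :=
  Complex.continuous_re.comp hσ.matrix_trace

end Continuity

/-! ### Twirling the outputs -/

section Twirl

variable {G : Type*} [Group G] [TopologicalSpace G] [IsTopologicalGroup G]
  [CompactSpace G] [MeasurableSpace G] [BorelSpace G]
  {μ : Measure G} [μ.IsHaarMeasure] [IsProbabilityMeasure μ]
  {b : Type*} [Fintype b] [DecidableEq b] {V : G →* Matrix.unitaryGroup b ℂ}

theorem continuous_overlap_bellVecOf (hV : Continuous V) {σ : G → Matrix (b × b) (b × b) ℂ}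
    (hσ : Continuous σ) : Continuous fun g => overlap (bellVecOf (V g : Matrix b b ℂ)) (σ g) := by
  have h : Continuous fun g => bellVecOf (V g : Matrix b b ℂ) :=
    (continuous_kronecker_one (continuous_coe_unitary hV)).matrix_mulVec continuous_const
  exact Complex.continuous_re.comp (h.star.dotProduct (hσ.matrix_mulVec h))

/-- The average of the outputs over the left translations, corrected by `V`. -/
noncomputable def leftTwirl (μ : Measure G) (V : G →* Matrix.unitaryGroup b ℂ)
    (σ : G → Matrix (b × b) (b × b) ℂ) (g : G) : Matrix (b × b) (b × b) ℂ :=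
  matAvg μ fun h => conjBy ((V h : Matrix b b ℂ) ⊗ₖ (1 : Matrix b b ℂ))ᴴ (σ (h * g))

/-- The average of the outputs over the right translations, corrected by `V`. -/
noncomputable def rightTwirl (μ : Measure G) (V : G →* Matrix.unitaryGroup b ℂ)
    (σ : G → Matrix (b × b) (b × b) ℂ) (g : G) : Matrix (b × b) (b × b) ℂ :=
  matAvg μ fun k => conjBy ((1 : Matrix b b ℂ) ⊗ₖ (V k : Matrix b b ℂ)ᵀ)ᴴ (σ (g * k))

theorem continuous_leftTwirl_integrand (hV : Continuous V) {σ : G → Matrix (b × b) (b × b) ℂ}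
    (hσ : Continuous σ) (g : G) : Continuous fun h =>
      conjBy ((V h : Matrix b b ℂ) ⊗ₖ (1 : Matrix b b ℂ))ᴴ (σ (h * g)) :=
  continuous_conjBy (continuous_kronecker_one (continuous_coe_unitary hV)).matrix_conjTranspose
    (hσ.comp (continuous_mul_const g))

theorem continuous_rightTwirl_integrand (hV : Continuous V) {σ : G → Matrix (b × b) (b × b) ℂ}
    (hσ : Continuous σ) (g : G) : Continuous fun k =>
      conjBy ((1 : Matrix b b ℂ) ⊗ₖ (V k : Matrix b b ℂ)ᵀ)ᴴ (σ (g * k)) :=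
  continuous_conjBy
    (continuous_one_kronecker_transpose (continuous_coe_unitary hV)).matrix_conjTranspose
    (hσ.comp (continuous_const_mul g))

/-- Moving `V_h` onto the target turns it into `|Φ_{V_{hg}}⟩`; the substitution `x = hg` needs right
invariance of `μ`. The result no longer depends on `g`. -/
theorem overlap_leftTwirl (hV : Continuous V) {σ : G → Matrix (b × b) (b × b) ℂ}
    (hσ : Continuous σ) (g : G) :
    overlap (bellVecOf (V g : Matrix b b ℂ)) (leftTwirl μ V σ g) =
      ∫ x, overlap (bellVecOf (V x : Matrix b b ℂ)) (σ x) ∂μ := by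
  rw [leftTwirl, overlap_matAvg _ (continuous_leftTwirl_integrand hV hσ g),
    ← integral_mul_right_of_continuous μ (continuous_overlap_bellVecOf hV hσ) g]
  refine integral_congr_ae (Filter.Eventually.of_forall fun h => ?_)
  simp only [overlap_conjBy_conjTranspose, kronecker_one_mulVec_bellVecOf, map_mul,
    Submonoid.coe_mul]

theorem reTrace_leftTwirl (hV : Continuous V) {σ : G → Matrix (b × b) (b × b) ℂ}
    (hσ : Continuous σ) (g : G) :
    reTrace (leftTwirl μ V σ g) = ∫ x, reTrace (σ x) ∂μ := by
  rw [leftTwirl, reTrace_matAvg (continuous_leftTwirl_integrand hV hσ g),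
    ← integral_mul_right_of_continuous μ (continuous_reTrace hσ) g]
  refine integral_congr_ae (Filter.Eventually.of_forall fun h => ?_)
  simp only [reTrace]
  rw [trace_conjBy (conjTranspose_mem_unitaryGroup (kronecker_one_mem_unitaryGroup (V h).2))]

/-- Here the substitution is `x = gk`, so left invariance suffices. -/
theorem overlap_rightTwirl (hV : Continuous V) {σ : G → Matrix (b × b) (b × b) ℂ}
    (hσ : Continuous σ) (g : G) :
    overlap (bellVecOf (V g : Matrix b b ℂ)) (rightTwirl μ V σ g) =
      ∫ x, overlap (bellVecOf (V x : Matrix b b ℂ)) (σ x) ∂μ := by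
  rw [rightTwirl, overlap_matAvg _ (continuous_rightTwirl_integrand hV hσ g),
    ← integral_mul_left_eq_self (fun x => overlap (bellVecOf (V x : Matrix b b ℂ)) (σ x)) g]
  refine integral_congr_ae (Filter.Eventually.of_forall fun h => ?_)
  simp only [overlap_conjBy_conjTranspose, one_kronecker_transpose_mulVec_bellVecOf, map_mul,
    Submonoid.coe_mul]

theorem reTrace_rightTwirl (hV : Continuous V) {σ : G → Matrix (b × b) (b × b) ℂ}
    (hσ : Continuous σ) (g : G) :
    reTrace (rightTwirl μ V σ g) = ∫ x, reTrace (σ x) ∂μ := by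
  rw [rightTwirl, reTrace_matAvg (continuous_rightTwirl_integrand hV hσ g),
    ← integral_mul_left_eq_self (fun x => reTrace (σ x)) g]
  refine integral_congr_ae (Filter.Eventually.of_forall fun h => ?_)
  simp only [reTrace]
  rw [trace_conjBy (conjTranspose_mem_unitaryGroup
    (one_kronecker_mem_unitaryGroup (transpose_mem_unitaryGroup (V h).2)))]

theorem integral_overlap_rightTwirl_leftTwirl (hV : Continuous V)
    {σ : G → Matrix (b × b) (b × b) ℂ} (hσ : Continuous σ) (hσ' : Continuous (leftTwirl μ V σ))
    (g : G) :
    overlap (bellVecOf (V g : Matrix b b ℂ)) (rightTwirl μ V (leftTwirl μ V σ) g) =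
      ∫ x, overlap (bellVecOf (V x : Matrix b b ℂ)) (σ x) ∂μ := by
  rw [overlap_rightTwirl hV hσ']
  simp only [overlap_leftTwirl hV hσ, integral_const, probReal_univ, one_smul]

theorem reTrace_rightTwirl_leftTwirl (hV : Continuous V)
    {σ : G → Matrix (b × b) (b × b) ℂ} (hσ : Continuous σ) (hσ' : Continuous (leftTwirl μ V σ))
    (g : G) :
    reTrace (rightTwirl μ V (leftTwirl μ V σ) g) = totalSuccess μ σ := by
  rw [reTrace_rightTwirl hV hσ', totalSuccess]
  simp only [reTrace_leftTwirl hV hσ, integral_const, probReal_univ, one_smul]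

end Twirl

/-! ### Bell state conversion -/

section BellOutput

variable {G : Type*} [Group G] {a b : Type*} [Fintype a] [DecidableEq a] [Fintype b]
  {U : G →* Matrix.unitaryGroup a ℂ}
  {M : Matrix (a × a) (a × a) ℂ →ₗ[ℂ] Matrix (b × b) (b × b) ℂ}

theorem trace_bellOutput [Nonempty a] {c : ℂ} (h : ∀ X, (M X).trace = c * X.trace) (g : G) :
    (bellOutput U M g).trace = c := by
  rw [bellOutput, h, trace_ketBra, star_bellVecOf_dotProduct_self (U g).2, mul_one]

theorem posSemidef_bellOutput (hM : IsCompletelyPositive M) (g : G) :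
    (bellOutput U M g).PosSemidef :=
  hM.posSemidef_map (posSemidef_ketBra _)

theorem continuous_bellOutput [TopologicalSpace G] (hU : Continuous U)
    (M : Matrix (a × a) (a × a) ℂ →ₗ[ℂ] Matrix (b × b) (b × b) ℂ) :
    Continuous (bellOutput U M) :=
  (continuous_linearMap M).comp (continuous_ketBra_bellVecOf (continuous_coe_unitary hU))

theorem bellDetValues_subset_bellProbValues [MeasurableSpace G] {μ : Measure G}
    [IsProbabilityMeasure μ] [DecidableEq b] {V : G →* Matrix.unitaryGroup b ℂ} [Nonempty a] :
    bellDetValues μ U V ⊆ bellProbValues μ U V := by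
  rintro F ⟨C, hC, rfl⟩
  have h1 : totalSuccess μ (bellOutput U C) = 1 :=
    totalSuccess_eq_one (trace_bellOutput fun X => by rw [hC.trace_map, one_mul])
  refine ⟨C, hC.isQuantumOperation, h1.symm ▸ one_pos, ?_⟩
  rw [probFidelity_eq_div _ (posSemidef_bellOutput hC.completelyPositive), h1, div_one, detFidelity]

end BellOutput

section Bell

variable {G : Type*} [Group G] [TopologicalSpace G] [IsTopologicalGroup G]
  [CompactSpace G] [MeasurableSpace G] [BorelSpace G]
  {μ : Measure G} [IsProbabilityMeasure μ]
  {a b : Type*} [Fintype a] [DecidableEq a] [Fintype b] [DecidableEq b]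
  {U : G →* Matrix.unitaryGroup a ℂ} {V : G →* Matrix.unitaryGroup b ℂ}

/-- The twirl of a conversion map over the left translations. -/
noncomputable def leftTwirlMap (μ : Measure G) [IsProbabilityMeasure μ] (hU : Continuous U)
    (hV : Continuous V) (M : Matrix (a × a) (a × a) ℂ →ₗ[ℂ] Matrix (b × b) (b × b) ℂ) :
    Matrix (a × a) (a × a) ℂ →ₗ[ℂ] Matrix (b × b) (b × b) ℂ :=
  avgMap μ (fun h => conjBy ((V h : Matrix b b ℂ) ⊗ₖ (1 : Matrix b b ℂ))ᴴ ∘ₗ M ∘ₗ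
      conjBy ((U h : Matrix a a ℂ) ⊗ₖ (1 : Matrix a a ℂ)))
    (continuous_comp_comp_conjBy (continuous_kronecker_one (continuous_coe_unitary hU))
      (continuous_kronecker_one (continuous_coe_unitary hV)).matrix_conjTranspose M)

/-- The twirl of a conversion map over the right translations. -/
noncomputable def rightTwirlMap (μ : Measure G) [IsProbabilityMeasure μ] (hU : Continuous U)
    (hV : Continuous V) (M : Matrix (a × a) (a × a) ℂ →ₗ[ℂ] Matrix (b × b) (b × b) ℂ) :
    Matrix (a × a) (a × a) ℂ →ₗ[ℂ] Matrix (b × b) (b × b) ℂ :=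
  avgMap μ (fun k => conjBy ((1 : Matrix b b ℂ) ⊗ₖ (V k : Matrix b b ℂ)ᵀ)ᴴ ∘ₗ M ∘ₗ
      conjBy ((1 : Matrix a a ℂ) ⊗ₖ (U k : Matrix a a ℂ)ᵀ))
    (continuous_comp_comp_conjBy
      (continuous_one_kronecker_transpose (continuous_coe_unitary hU))
      (continuous_one_kronecker_transpose (continuous_coe_unitary hV)).matrix_conjTranspose M)

variable {M : Matrix (a × a) (a × a) ℂ →ₗ[ℂ] Matrix (b × b) (b × b) ℂ}

theorem bellOutput_leftTwirlMap (hU : Continuous U) (hV : Continuous V) :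
    bellOutput U (leftTwirlMap μ hU hV M) = leftTwirl μ V (bellOutput U M) := by
  funext g
  simp only [bellOutput, leftTwirlMap, avgMap_apply, leftTwirl, LinearMap.comp_apply,
    conjBy_ketBra, kronecker_one_mulVec_bellVecOf, map_mul, Submonoid.coe_mul]

theorem bellOutput_rightTwirlMap (hU : Continuous U) (hV : Continuous V) :
    bellOutput U (rightTwirlMap μ hU hV M) = rightTwirl μ V (bellOutput U M) := by
  funext g
  simp only [bellOutput, rightTwirlMap, avgMap_apply, rightTwirl, LinearMap.comp_apply,
    conjBy_ketBra, one_kronecker_transpose_mulVec_bellVecOf, map_mul, Submonoid.coe_mul]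

theorem IsCompletelyPositive.leftTwirlMap (hU : Continuous U) (hV : Continuous V)
    (hM : IsCompletelyPositive M) : IsCompletelyPositive (leftTwirlMap μ hU hV M) :=
  IsCompletelyPositive.avgMap _ fun _ => (isCompletelyPositive_conjBy _).comp
    (hM.comp (isCompletelyPositive_conjBy _))

theorem IsCompletelyPositive.rightTwirlMap (hU : Continuous U) (hV : Continuous V)
    (hM : IsCompletelyPositive M) : IsCompletelyPositive (rightTwirlMap μ hU hV M) :=
  IsCompletelyPositive.avgMap _ fun _ => (isCompletelyPositive_conjBy _).comp
    (hM.comp (isCompletelyPositive_conjBy _))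

theorem trace_leftTwirlMap (hU : Continuous U) (hV : Continuous V) (X : Matrix (a × a) (a × a) ℂ) :
    (leftTwirlMap μ hU hV M X).trace =
      ∫ h, (M (conjBy ((U h : Matrix a a ℂ) ⊗ₖ (1 : Matrix a a ℂ)) X)).trace ∂μ := by
  rw [leftTwirlMap, avgMap_apply, trace_matAvg]
  · refine integral_congr_ae (Filter.Eventually.of_forall fun h => ?_)
    exact trace_conjBy
      (conjTranspose_mem_unitaryGroup (kronecker_one_mem_unitaryGroup (V h).2)) _
  · exact continuous_comp_comp_conjBy (continuous_kronecker_one (continuous_coe_unitary hU))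
      (continuous_kronecker_one (continuous_coe_unitary hV)).matrix_conjTranspose M X

theorem trace_rightTwirlMap (hU : Continuous U) (hV : Continuous V)
    (X : Matrix (a × a) (a × a) ℂ) :
    (rightTwirlMap μ hU hV M X).trace =
      ∫ k, (M (conjBy ((1 : Matrix a a ℂ) ⊗ₖ (U k : Matrix a a ℂ)ᵀ) X)).trace ∂μ := by
  rw [rightTwirlMap, avgMap_apply, trace_matAvg]
  · refine integral_congr_ae (Filter.Eventually.of_forall fun h => ?_)
    exact trace_conjBy (conjTranspose_mem_unitaryGroup
      (one_kronecker_mem_unitaryGroup (transpose_mem_unitaryGroup (V h).2))) _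
  · exact continuous_comp_comp_conjBy
      (continuous_one_kronecker_transpose (continuous_coe_unitary hU))
      (continuous_one_kronecker_transpose (continuous_coe_unitary hV)).matrix_conjTranspose M X

variable [μ.IsHaarMeasure]

theorem trace_leftTwirlMap_conjBy (hU : Continuous U) (hV : Continuous V) (g : G)
    (X : Matrix (a × a) (a × a) ℂ) :
    (leftTwirlMap μ hU hV M
      (conjBy ((U g : Matrix a a ℂ) ⊗ₖ (1 : Matrix a a ℂ)) X)).trace =
      (leftTwirlMap μ hU hV M X).trace := by
  rw [trace_leftTwirlMap, trace_leftTwirlMap]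
  have hc : Continuous fun h =>
      (M (conjBy ((U h : Matrix a a ℂ) ⊗ₖ (1 : Matrix a a ℂ)) X)).trace :=
    ((continuous_linearMap M).comp (continuous_conjBy
      (continuous_kronecker_one (continuous_coe_unitary hU)) continuous_const)).matrix_trace
  rw [← integral_mul_right_of_continuous_complex μ hc g]
  refine integral_congr_ae (Filter.Eventually.of_forall fun h => ?_)
  simp only [conjBy_conjBy, ← Matrix.mul_kronecker_mul, one_mul, map_mul, Submonoid.coe_mul]

/-- The invariance gained from the left twirl survives the right one because `U_g ⊗ I` and `I ⊗
U_hᵀ` commute. The right invariance uses `U_hᵀ U_gᵀ = (U_{gh})ᵀ`. -/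
theorem trace_twirlMap_eq (hU : Continuous U) (hV : Continuous V)
    (hirr : (toRep U).IsIrreducible) : ∃ c : ℂ, ∀ X : Matrix (a × a) (a × a) ℂ,
      (rightTwirlMap μ hU hV (leftTwirlMap μ hU hV M) X).trace = c * X.trace := by
  refine exists_trace_of_invariant_both hirr (Matrix.traceLinearMap _ ℂ ℂ ∘ₗ
    rightTwirlMap μ hU hV (leftTwirlMap μ hU hV M)) (fun g X => ?_) fun g X => ?_
  · change (rightTwirlMap μ hU hV (leftTwirlMap μ hU hV M) (conjBy _ X)).trace =
      (rightTwirlMap μ hU hV (leftTwirlMap μ hU hV M) X).trace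
    rw [trace_rightTwirlMap, trace_rightTwirlMap]
    refine integral_congr_ae (Filter.Eventually.of_forall fun h => ?_)
    have := trace_leftTwirlMap_conjBy (μ := μ) (M := M) hU hV g
      (conjBy ((1 : Matrix a a ℂ) ⊗ₖ (U h : Matrix a a ℂ)ᵀ) X)
    simp only [conjBy_conjBy, ← Matrix.mul_kronecker_mul, one_mul, mul_one] at this ⊢
    exact this
  · change (rightTwirlMap μ hU hV (leftTwirlMap μ hU hV M) (conjBy _ X)).trace =
      (rightTwirlMap μ hU hV (leftTwirlMap μ hU hV M) X).trace
    rw [trace_rightTwirlMap, trace_rightTwirlMap, ← integral_mul_left_eq_self (fun k =>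
      (leftTwirlMap μ hU hV M
        (conjBy ((1 : Matrix a a ℂ) ⊗ₖ (U k : Matrix a a ℂ)ᵀ) X)).trace) g]
    refine integral_congr_ae (Filter.Eventually.of_forall fun h => ?_)
    simp only [conjBy_conjBy, ← Matrix.mul_kronecker_mul, one_mul, map_mul, Submonoid.coe_mul,
      Matrix.transpose_mul]

/-- Every completely positive map with nonzero success probability can be replaced by a channel with
the same conditional fidelity. -/
theorem exists_channel_detFidelity_eq (hU : Continuous U) (hV : Continuous V)
    (hirr : (toRep U).IsIrreducible) (hM : IsCompletelyPositive M)
    (hp : 0 < totalSuccess μ (bellOutput U M)) :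
    ∃ C : Matrix (a × a) (a × a) ℂ →ₗ[ℂ] Matrix (b × b) (b × b) ℂ, IsChannel C ∧
      detFidelity μ (fun g => bellVecOf (V g : Matrix b b ℂ)) (bellOutput U C) =
        (∫ g, overlap (bellVecOf (V g : Matrix b b ℂ)) (bellOutput U M g) ∂μ) /
          totalSuccess μ (bellOutput U M) := by
  have := nonempty_of_isIrreducible hirr
  set p := totalSuccess μ (bellOutput U M) with hpdef
  let M' := rightTwirlMap μ hU hV (leftTwirlMap μ hU hV M)
  have hM' : IsCompletelyPositive M' := (hM.leftTwirlMap hU hV).rightTwirlMap hU hV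
  have hout : bellOutput U M' = rightTwirl μ V (leftTwirl μ V (bellOutput U M)) := by
    rw [bellOutput_rightTwirlMap, bellOutput_leftTwirlMap]
  have hσ := continuous_bellOutput hU M
  -- The twirled outputs are the outputs of a twirled map, hence continuous.
  have hσ' : Continuous (leftTwirl μ V (bellOutput U M)) := by
    rw [← bellOutput_leftTwirlMap hU hV]
    exact continuous_bellOutput hU _
  obtain ⟨c, hc⟩ := trace_twirlMap_eq (μ := μ) (M := M) hU hV hirr
  -- Evaluated on the Bell state at the identity, `c` is the trace of a twirled output, which is `p`
  -- at every group element.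
  have hcp : c = (p : ℂ) := by
    rw [eq_reTrace_of_trace_eq (posSemidef_bellOutput hM' 1) (trace_bellOutput (U := U) hc 1),
      hout, reTrace_rightTwirl_leftTwirl hV hσ hσ']
  refine ⟨p⁻¹ • M', ⟨hM'.smul (inv_nonneg.2 hp.le), fun X => ?_⟩, ?_⟩
  · rw [LinearMap.smul_apply, Matrix.trace_smul, hc, hcp, Complex.real_smul, ← mul_assoc,
      ← Complex.ofReal_mul, inv_mul_cancel₀ hp.ne', Complex.ofReal_one, one_mul]
  · have hov : ∀ g, overlap (bellVecOf (V g : Matrix b b ℂ)) (bellOutput U (p⁻¹ • M') g) =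
        (∫ g, overlap (bellVecOf (V g : Matrix b b ℂ)) (bellOutput U M g) ∂μ) / p := fun g => by
      have : bellOutput U (p⁻¹ • M') g = p⁻¹ • bellOutput U M' g := rfl
      rw [this, overlap_smul, hout, integral_overlap_rightTwirl_leftTwirl hV hσ hσ',
        inv_mul_eq_div]
    rw [detFidelity]
    simp only [hov, integral_const, probReal_univ, one_smul]

theorem bellProbValues_subset_bellDetValues (hU : Continuous U) (hV : Continuous V)
    (hirr : (toRep U).IsIrreducible) : bellProbValues μ U V ⊆ bellDetValues μ U V := by
  rintro F ⟨M, hM, hp, rfl⟩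
  obtain ⟨C, hC, hF⟩ := exists_channel_detFidelity_eq (V := V) hU hV hirr hM.completelyPositive hp
  refine ⟨C, hC, ?_⟩
  rw [hF, probFidelity_eq_div _ (posSemidef_bellOutput hM.completelyPositive)]

theorem isLUB_bellFidelity [Nonempty b] (hU : Continuous U) (hV : Continuous V)
    (hirr : (toRep U).IsIrreducible) :
    IsLUB (bellDetValues μ U V) (bellDetFidelity μ U V) ∧
      IsLUB (bellProbValues μ U V) (bellProbFidelity μ U V) ∧
      bellDetFidelity μ U V = bellProbFidelity μ U V := by
  have := nonempty_of_isIrreducible hirr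
  obtain ⟨e⟩ := ‹Nonempty b›
  have hbdd : BddAbove (bellDetValues μ U V) := by
    refine ⟨1, ?_⟩
    rintro F ⟨C, hC, rfl⟩
    exact detFidelity_le_one (fun g => star_bellVecOf_dotProduct_self (V g).2)
      (posSemidef_bellOutput hC.completelyPositive)
      (trace_bellOutput fun X => by rw [hC.trace_map, one_mul])
  exact isLUB_sSup_and_eq bellDetValues_subset_bellProbValues
    ⟨_, _, isChannel_prepare_single (e, e), rfl⟩ hbdd fun F hF =>
      le_csSup hbdd (bellProbValues_subset_bellDetValues hU hV hirr hF)

end Bell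

/-! ### Positive definite matrices and their factorization. -/

section PosDef

variable {m : Type*} [Fintype m] [DecidableEq m]

/-- Positivity in the order of `ℂ` includes being real, and a complex matrix with real quadratic
form is Hermitian. -/
theorem posDef_of_forall_pos {S : Matrix m m ℂ}
    (h : ∀ x : m → ℂ, x ≠ 0 → 0 < star x ⬝ᵥ (S *ᵥ x)) : S.PosDef := by
  refine Matrix.PosDef.of_dotProduct_mulVec_pos ?_ fun {x} hx => h x hx
  rw [← Matrix.isSymmetric_toEuclideanLin_iff, LinearMap.isSymmetric_iff_inner_map_self_real]
  intro v
  have hreal : (star v.ofLp ⬝ᵥ (S *ᵥ v.ofLp)).im = 0 := by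
    by_cases hv : v.ofLp = 0
    · simp [hv]
    · exact (Complex.lt_def.1 (h _ hv)).2.symm
  have hin : inner ℂ (Matrix.toEuclideanLin S v) v = star (star v.ofLp ⬝ᵥ (S *ᵥ v.ofLp)) := by
    rw [Matrix.star_dotProduct, star_star]
    simp [EuclideanSpace.inner_eq_star_dotProduct, dotProduct_comm]
  have hconj : star (star v.ofLp ⬝ᵥ (S *ᵥ v.ofLp)) = star v.ofLp ⬝ᵥ (S *ᵥ v.ofLp) :=
    Complex.conj_eq_iff_im.2 hreal
  rw [hin, hconj]
  exact hconj

open scoped MatrixOrder in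
theorem exists_isUnit_eq_conjTranspose_mul_self {S : Matrix m m ℂ} (hS : S.PosDef) :
    ∃ R : Matrix m m ℂ, IsUnit R.det ∧ S = Rᴴ * R := by
  obtain ⟨R, hR⟩ := CStarAlgebra.nonneg_iff_eq_star_mul_self.mp hS.posSemidef.nonneg
  have hu := (Matrix.isUnit_iff_isUnit_det _).1 hS.isUnit
  rw [hR, Matrix.det_mul] at hu
  exact ⟨R, isUnit_of_mul_isUnit_right hu, hR⟩

end PosDef

/-! ### Gate simulation -/

section Network

variable {G : Type*} [Group G] {a b m : Type*} [Fintype a] [DecidableEq a] [Fintype b]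
  [DecidableEq b] [Fintype m] [DecidableEq m] {U : G →* Matrix.unitaryGroup a ℂ}
  {A : Matrix b b ℂ →ₗ[ℂ] Matrix (a × m) (a × m) ℂ}
  {B : Matrix (a × m) (a × m) ℂ →ₗ[ℂ] Matrix b b ℂ}

theorem IsCompletelyPositive.networkMap (hA : IsCompletelyPositive A)
    (hB : IsCompletelyPositive B) (W : Matrix a a ℂ) :
    IsCompletelyPositive (networkMap A B W) :=
  hB.comp ((isCompletelyPositive_conjBy _).comp hA)

theorem posSemidef_gateOutput (hA : IsCompletelyPositive A) (hB : IsCompletelyPositive B) (g : G) :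
    (gateOutput U A B g).PosSemidef :=
  (hA.networkMap hB _).posSemidef_applyLeft (posSemidef_ketBra _)

theorem trace_gateOutput [Nonempty b] {c : ℂ} (hA : ∀ X, (A X).trace = c * X.trace)
    (hB : ∀ Y, (B Y).trace = Y.trace) (g : G) : (gateOutput U A B g).trace = c := by
  have h : ∀ X, (networkMap A B (U g : Matrix a a ℂ) X).trace = c * X.trace := fun X => by
    rw [BellConversion.networkMap, LinearMap.comp_apply, LinearMap.comp_apply, hB,
      trace_conjBy (kronecker_one_mem_unitaryGroup (U g).2), hA]
  rw [gateOutput, trace_applyLeft h, trace_ketBra, ← bellVecOf_one,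
    star_bellVecOf_dotProduct_self (one_mem _), mul_one]

theorem gateOutput_smul (r : ℝ) (g : G) :
    gateOutput U (r • A) B g = r • gateOutput U A B g := by
  ext p q
  simp only [gateOutput, applyLeft, BellConversion.networkMap, Matrix.of_apply, Matrix.smul_apply,
    LinearMap.comp_apply, LinearMap.smul_apply, LinearMap.map_smul_of_tower]

theorem gateOutput_add_smul (B' : Matrix (a × m) (a × m) ℂ →ₗ[ℂ] Matrix b b ℂ) (r : ℝ) (g : G) :
    gateOutput U A (B + r • B') g = gateOutput U A B g + r • gateOutput U A B' g := rfl

/-- An invertible operator on the memory can be moved from the second to the first operation of a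
network. -/
theorem gateOutput_conj_memory {R : Matrix m m ℂ} (hR : IsUnit R.det) :
    gateOutput U (conjBy ((1 : Matrix a a ℂ) ⊗ₖ R) ∘ₗ A)
      (B ∘ₗ conjBy ((1 : Matrix a a ℂ) ⊗ₖ R⁻¹)) = gateOutput U A B := by
  have h : ∀ W : Matrix a a ℂ, networkMap (conjBy ((1 : Matrix a a ℂ) ⊗ₖ R) ∘ₗ A)
      (B ∘ₗ conjBy ((1 : Matrix a a ℂ) ⊗ₖ R⁻¹)) W = networkMap A B W := fun W => by
    ext1 X
    simp only [BellConversion.networkMap, LinearMap.comp_apply, conjBy_conjBy,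
      ← Matrix.mul_kronecker_mul, one_mul, mul_one, Matrix.nonsing_inv_mul R hR]
  funext g
  rw [gateOutput, h, gateOutput]

variable [TopologicalSpace G]

theorem continuous_networkMap (hU : Continuous U)
    (A : Matrix b b ℂ →ₗ[ℂ] Matrix (a × m) (a × m) ℂ)
    (B : Matrix (a × m) (a × m) ℂ →ₗ[ℂ] Matrix b b ℂ) (X : Matrix b b ℂ) :
    Continuous fun g => networkMap A B (U g : Matrix a a ℂ) X :=
  (continuous_linearMap B).comp (continuous_conjBy
    (continuous_kronecker_one (continuous_coe_unitary hU)) continuous_const)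

theorem continuous_gateOutput (hU : Continuous U)
    (A : Matrix b b ℂ →ₗ[ℂ] Matrix (a × m) (a × m) ℂ)
    (B : Matrix (a × m) (a × m) ℂ →ₗ[ℂ] Matrix b b ℂ) : Continuous (gateOutput U A B) :=
  continuous_applyLeft (S := fun g => networkMap A B (U g : Matrix a a ℂ))
    (continuous_networkMap hU A B) _ _

end Network

/-! ### Twirling the two operations of a network. -/

section NetworkTwirl

variable {G : Type*} [Group G] [TopologicalSpace G] [IsTopologicalGroup G]
  [CompactSpace G] [MeasurableSpace G] [BorelSpace G]
  {μ : Measure G} [IsProbabilityMeasure μ]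
  {a b m : Type*} [Fintype a] [DecidableEq a] [Fintype b] [DecidableEq b] [Fintype m]
  [DecidableEq m]
  {U : G →* Matrix.unitaryGroup a ℂ} {V : G →* Matrix.unitaryGroup b ℂ}

/-- The twirl of the second operation of a network. -/
noncomputable def decoderTwirl (μ : Measure G) [IsProbabilityMeasure μ] (hU : Continuous U)
    (hV : Continuous V) (B : Matrix (a × m) (a × m) ℂ →ₗ[ℂ] Matrix b b ℂ) :
    Matrix (a × m) (a × m) ℂ →ₗ[ℂ] Matrix b b ℂ :=
  avgMap μ (fun h => conjBy (V h : Matrix b b ℂ)ᴴ ∘ₗ B ∘ₗ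
      conjBy ((U h : Matrix a a ℂ) ⊗ₖ (1 : Matrix m m ℂ)))
    (continuous_comp_comp_conjBy (continuous_kronecker_one (continuous_coe_unitary hU))
      (continuous_coe_unitary hV).matrix_conjTranspose B)

/-- The twirl of the first operation of a network. -/
noncomputable def encoderTwirl (μ : Measure G) [IsProbabilityMeasure μ] (hU : Continuous U)
    (hV : Continuous V) (A : Matrix b b ℂ →ₗ[ℂ] Matrix (a × m) (a × m) ℂ) :
    Matrix b b ℂ →ₗ[ℂ] Matrix (a × m) (a × m) ℂ :=
  avgMap μ (fun k => conjBy ((U k : Matrix a a ℂ) ⊗ₖ (1 : Matrix m m ℂ)) ∘ₗ A ∘ₗ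
      conjBy (V k : Matrix b b ℂ)ᴴ)
    (continuous_comp_comp_conjBy (continuous_coe_unitary hV).matrix_conjTranspose
      (continuous_kronecker_one (continuous_coe_unitary hU)) A)

variable {A : Matrix b b ℂ →ₗ[ℂ] Matrix (a × m) (a × m) ℂ}
  {B : Matrix (a × m) (a × m) ℂ →ₗ[ℂ] Matrix b b ℂ}

theorem IsCompletelyPositive.decoderTwirl (hU : Continuous U) (hV : Continuous V)
    (hB : IsCompletelyPositive B) : IsCompletelyPositive (decoderTwirl μ hU hV B) :=
  IsCompletelyPositive.avgMap _ fun _ => (isCompletelyPositive_conjBy _).comp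
    (hB.comp (isCompletelyPositive_conjBy _))

theorem IsCompletelyPositive.encoderTwirl (hU : Continuous U) (hV : Continuous V)
    (hA : IsCompletelyPositive A) : IsCompletelyPositive (encoderTwirl μ hU hV A) :=
  IsCompletelyPositive.avgMap _ fun _ => (isCompletelyPositive_conjBy _).comp
    (hA.comp (isCompletelyPositive_conjBy _))

theorem gateOutput_decoderTwirl (hU : Continuous U) (hV : Continuous V) :
    gateOutput U A (decoderTwirl μ hU hV B) = leftTwirl μ V (gateOutput U A B) := by
  funext g
  have h1 : gateOutput U A (decoderTwirl μ hU hV B) g = matAvg μ fun h =>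
      applyLeft b (conjBy (V h : Matrix b b ℂ)ᴴ) (applyLeft b
        ((B ∘ₗ conjBy ((U h : Matrix a a ℂ) ⊗ₖ (1 : Matrix m m ℂ))) ∘ₗ
          conjBy ((U g : Matrix a a ℂ) ⊗ₖ (1 : Matrix m m ℂ)) ∘ₗ A) (ketBra (bellVec b))) := rfl
  rw [h1, leftTwirl]
  congr 1
  funext h
  rw [applyLeft_conjBy, Matrix.conjTranspose_kronecker, Matrix.conjTranspose_one, gateOutput,
    BellConversion.networkMap, LinearMap.comp_assoc, ← LinearMap.comp_assoc A, conjBy_comp_conjBy,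
    ← Matrix.mul_kronecker_mul, one_mul, map_mul, Submonoid.coe_mul]

/-- `U_k` after the first operation merges with the gate into `U_{gk}`. `V_k†` before it acts on
half of a Bell state and is transposed onto the reference system, where it is the correction of the
right twirl. -/
theorem gateOutput_encoderTwirl (hU : Continuous U) (hV : Continuous V) :
    gateOutput U (encoderTwirl μ hU hV A) B = rightTwirl μ V (gateOutput U A B) := by
  funext g
  have h1 : gateOutput U (encoderTwirl μ hU hV A) B g = matAvg μ fun k =>
      applyLeft b (networkMap A B (U (g * k) : Matrix a a ℂ)) (applyLeft b
        (conjBy (V k : Matrix b b ℂ)ᴴ) (ketBra (bellVec b))) := by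
    ext p q
    set Y : Matrix b b ℂ := Matrix.of fun i j => ketBra (bellVec b) (i, p.2) (j, q.2)
    -- The average over `k` is pulled through the gate and the second operation by linearity.
    have h2 := congrFun (congrFun (linearMap_matAvg (μ := μ)
      (B ∘ₗ conjBy ((U g : Matrix a a ℂ) ⊗ₖ (1 : Matrix m m ℂ)))
      (continuous_comp_comp_conjBy (continuous_coe_unitary hV).matrix_conjTranspose
        (continuous_kronecker_one (c := m) (continuous_coe_unitary hU)) A Y)) p.1) q.1
    refine h2.trans ?_
    change ∫ k, _ ∂μ = ∫ k, _ ∂μ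
    refine integral_congr_ae (Filter.Eventually.of_forall fun k => ?_)
    change _ = networkMap A B (U (g * k) : Matrix a a ℂ) (conjBy (V k : Matrix b b ℂ)ᴴ Y) p.1 q.1
    simp only [BellConversion.networkMap, LinearMap.comp_apply, conjBy_conjBy,
      ← Matrix.mul_kronecker_mul, one_mul, map_mul, Submonoid.coe_mul]
  rw [h1, rightTwirl]
  congr 1
  funext k
  -- `V_k†` is written as `1 * V_k†` so that the transpose trick can move it to the reference.
  rw [applyLeft_conjBy, conjBy_ketBra, ← bellVecOf_one, kronecker_one_mulVec_bellVecOf, mul_one,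
    ← one_mul (V k : Matrix b b ℂ)ᴴ, ← one_kronecker_transpose_mulVec_bellVecOf, ← conjBy_ketBra,
    applyLeft_conjBy_one_kronecker, Matrix.conjTranspose_kronecker, Matrix.conjTranspose_one,
    bellVecOf_one]
  rfl

theorem trace_decoderTwirl (hU : Continuous U) (hV : Continuous V)
    (Y : Matrix (a × m) (a × m) ℂ) :
    (decoderTwirl μ hU hV B Y).trace =
      ∫ h, (B (conjBy ((U h : Matrix a a ℂ) ⊗ₖ (1 : Matrix m m ℂ)) Y)).trace ∂μ := by
  rw [BellConversion.decoderTwirl, avgMap_apply, trace_matAvg]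
  · refine integral_congr_ae (Filter.Eventually.of_forall fun h => ?_)
    exact trace_conjBy (conjTranspose_mem_unitaryGroup (V h).2) _
  · exact continuous_comp_comp_conjBy (continuous_kronecker_one (continuous_coe_unitary hU))
      (continuous_coe_unitary hV).matrix_conjTranspose B Y

theorem trace_encoderTwirl (hU : Continuous U) (hV : Continuous V) (X : Matrix b b ℂ) :
    (encoderTwirl μ hU hV A X).trace =
      ∫ k, (A (conjBy (V k : Matrix b b ℂ)ᴴ X)).trace ∂μ := by
  rw [BellConversion.encoderTwirl, avgMap_apply, trace_matAvg]
  · refine integral_congr_ae (Filter.Eventually.of_forall fun h => ?_)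
    exact trace_conjBy (kronecker_one_mem_unitaryGroup (U h).2) _
  · exact continuous_comp_comp_conjBy (continuous_coe_unitary hV).matrix_conjTranspose
      (continuous_kronecker_one (continuous_coe_unitary hU)) A X

theorem continuous_trace_decoder (hU : Continuous U) (Y : Matrix (a × m) (a × m) ℂ) :
    Continuous fun h =>
      (B (conjBy ((U h : Matrix a a ℂ) ⊗ₖ (1 : Matrix m m ℂ)) Y)).trace :=
  ((continuous_linearMap B).comp (continuous_conjBy
    (continuous_kronecker_one (continuous_coe_unitary hU)) continuous_const)).matrix_trace

/-- If `B` does not decrease traces by more than a factor `ε`, neither does its twirl. -/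
theorem mul_reTrace_le_reTrace_decoderTwirl (hU : Continuous U) (hV : Continuous V) {ε : ℝ}
    (hB : ∀ Y : Matrix (a × m) (a × m) ℂ, Y.PosSemidef → ε * reTrace Y ≤ reTrace (B Y))
    {Y : Matrix (a × m) (a × m) ℂ} (hY : Y.PosSemidef) :
    ε * reTrace Y ≤ reTrace (decoderTwirl μ hU hV B Y) := by
  have hc := continuous_trace_decoder (B := B) hU Y
  have hle := integral_mono (μ := μ) (f := fun _ => ε * reTrace Y) (integrable_const _)
    (integrable_of_continuous μ (Complex.continuous_re.comp hc)) fun h => ?_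
  · rw [integral_const, probReal_univ, one_smul] at hle
    rw [reTrace.eq_def (decoderTwirl μ hU hV B Y), trace_decoderTwirl,
      integral_re_of_continuous hc]
    exact hle
  · have h1 := hB _ (hY.mul_mul_conjTranspose_same
      ((U h : Matrix a a ℂ) ⊗ₖ (1 : Matrix m m ℂ)))
    have h2 := trace_conjBy (kronecker_one_mem_unitaryGroup (m := m) (U h).2) Y
    rw [conjBy_apply] at h2
    rw [reTrace, h2] at h1
    exact h1

variable [μ.IsHaarMeasure]

theorem exists_trace_decoderTwirl_eq (hU : Continuous U) (hV : Continuous V)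
    (hirr : (toRep U).IsIrreducible) : ∃ S : Matrix m m ℂ, ∀ Y,
      (decoderTwirl μ hU hV B Y).trace = ((1 : Matrix a a ℂ) ⊗ₖ S * Y).trace := by
  refine exists_trace_of_invariant_left hirr
    (Matrix.traceLinearMap _ ℂ ℂ ∘ₗ decoderTwirl μ hU hV B) fun g Y => ?_
  change (decoderTwirl μ hU hV B (conjBy _ Y)).trace = (decoderTwirl μ hU hV B Y).trace
  rw [trace_decoderTwirl, trace_decoderTwirl,
    ← integral_mul_right_of_continuous_complex μ (continuous_trace_decoder hU Y) g]
  refine integral_congr_ae (Filter.Eventually.of_forall fun h => ?_)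
  simp only [conjBy_conjBy, ← Matrix.mul_kronecker_mul, one_mul, map_mul, Submonoid.coe_mul]

theorem exists_trace_encoderTwirl_eq (hU : Continuous U) (hV : Continuous V)
    (hirr : (toRep V).IsIrreducible) : ∃ c : ℂ, ∀ X,
      (encoderTwirl μ hU hV A X).trace = c * X.trace := by
  refine exists_trace_of_invariant hirr
    (Matrix.traceLinearMap _ ℂ ℂ ∘ₗ encoderTwirl μ hU hV A) fun g X => ?_
  change (encoderTwirl μ hU hV A (conjBy _ X)).trace = (encoderTwirl μ hU hV A X).trace
  -- Since `V_k† V_g = (V_{g⁻¹k})†`, the invariance comes from left translation by `g⁻¹`.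
  rw [trace_encoderTwirl, trace_encoderTwirl, ← integral_mul_left_eq_self
    (fun k => (A (conjBy (V k : Matrix b b ℂ)ᴴ X)).trace) g⁻¹]
  refine integral_congr_ae (Filter.Eventually.of_forall fun k => ?_)
  have hinv : ((V g⁻¹ : Matrix.unitaryGroup b ℂ) : Matrix b b ℂ) = (V g : Matrix b b ℂ)ᴴ := by
    rw [map_inv]
    rfl
  simp only [conjBy_conjBy, map_mul, Submonoid.coe_mul, hinv, Matrix.conjTranspose_mul,
    Matrix.conjTranspose_conjTranspose]

/-- If the second operation of a network has nonzero success probability on all states, its twirl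
is a channel up to an invertible operator on the memory. -/
theorem exists_isChannel_decoderTwirl_comp (hU : Continuous U) (hV : Continuous V)
    (hirr : (toRep U).IsIrreducible) (hB : IsCompletelyPositive B) {ε : ℝ} (hε : 0 < ε)
    (hBε : ∀ Y : Matrix (a × m) (a × m) ℂ, Y.PosSemidef → ε * reTrace Y ≤ reTrace (B Y)) :
    ∃ R : Matrix m m ℂ, IsUnit R.det ∧
      IsChannel (decoderTwirl μ hU hV B ∘ₗ conjBy ((1 : Matrix a a ℂ) ⊗ₖ R⁻¹)) := by
  obtain ⟨S, hS⟩ := exists_trace_decoderTwirl_eq (μ := μ) (B := B) hU hV hirr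
  have hcp := hB.decoderTwirl (μ := μ) hU hV
  obtain ⟨e⟩ := nonempty_of_isIrreducible hirr
  -- On `|e⟩⟨e| ⊗ |x⟩⟨x|` the trace of the twirl is `⟨x|S|x⟩`, bounded below by `ε⟨x|x⟩`.
  have hpos : S.PosDef := by
    refine posDef_of_forall_pos fun x hx => ?_
    have hY : (Matrix.single e e (1 : ℂ) ⊗ₖ ketBra x).PosSemidef :=
      (posSemidef_single e).kronecker (posSemidef_ketBra x)
    have htr : (Matrix.single e e (1 : ℂ) ⊗ₖ ketBra x).trace = star x ⬝ᵥ x := by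
      rw [Matrix.trace_kronecker, Matrix.trace_single_eq_same, one_mul, trace_ketBra]
    have hout : (decoderTwirl μ hU hV B (Matrix.single e e (1 : ℂ) ⊗ₖ ketBra x)).trace =
        star x ⬝ᵥ (S *ᵥ x) := by
      rw [hS, ← Matrix.mul_kronecker_mul, one_mul, Matrix.trace_kronecker,
        Matrix.trace_single_eq_same, one_mul, ketBra, Matrix.mul_vecMulVec,
        Matrix.trace_vecMulVec, dotProduct_comm]
    have h1 := mul_reTrace_le_reTrace_decoderTwirl (μ := μ) hU hV hBε hY
    have h2 := eq_reTrace_of_trace_eq (hcp.posSemidef_map hY) rfl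
    have h3 : 0 < (star x ⬝ᵥ x).re :=
      (Complex.lt_def.1 (Matrix.dotProduct_star_self_pos_iff.2 hx)).1
    rw [reTrace, htr] at h1
    rw [← hout, h2]
    exact Complex.zero_lt_real.2 ((mul_pos hε h3).trans_le h1)
  obtain ⟨R, hR, rfl⟩ := exists_isUnit_eq_conjTranspose_mul_self hpos
  refine ⟨R, hR, hcp.comp (isCompletelyPositive_conjBy _), fun Y => ?_⟩
  rw [LinearMap.comp_apply, hS, conjBy_apply, Matrix.conjTranspose_kronecker,
    Matrix.conjTranspose_one, mul_assoc, ← mul_assoc, ← Matrix.mul_kronecker_mul, one_mul,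
    ← mul_assoc, Matrix.trace_mul_comm, ← mul_assoc, ← Matrix.mul_kronecker_mul, one_mul,
    mul_assoc Rᴴ, Matrix.mul_nonsing_inv R hR, mul_one, ← Matrix.conjTranspose_mul,
    Matrix.mul_nonsing_inv R hR, Matrix.conjTranspose_one, Matrix.one_kronecker_one, one_mul]

/-- Every network of completely positive maps, the second of which has nonzero success probability
on all states, can be replaced by a deterministic one with the same conditional fidelity. -/
theorem exists_channels_detFidelity_eq [Nonempty b] (hU : Continuous U) (hV : Continuous V)
    (hirrU : (toRep U).IsIrreducible) (hirrV : (toRep V).IsIrreducible)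
    (hA : IsCompletelyPositive A) (hB : IsCompletelyPositive B) {ε : ℝ} (hε : 0 < ε)
    (hBε : ∀ Y : Matrix (a × m) (a × m) ℂ, Y.PosSemidef → ε * reTrace Y ≤ reTrace (B Y))
    (hp : 0 < totalSuccess μ (gateOutput U A B)) :
    ∃ (A' : Matrix b b ℂ →ₗ[ℂ] Matrix (a × m) (a × m) ℂ)
      (B' : Matrix (a × m) (a × m) ℂ →ₗ[ℂ] Matrix b b ℂ), IsChannel A' ∧ IsChannel B' ∧
      detFidelity μ (fun g => bellVecOf (V g : Matrix b b ℂ)) (gateOutput U A' B') =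
        (∫ g, overlap (bellVecOf (V g : Matrix b b ℂ)) (gateOutput U A B g) ∂μ) /
          totalSuccess μ (gateOutput U A B) := by
  set p := totalSuccess μ (gateOutput U A B)
  obtain ⟨R, hR, hB'⟩ := exists_isChannel_decoderTwirl_comp (μ := μ) hU hV hirrU hB hε hBε
  set B' := decoderTwirl μ hU hV B ∘ₗ conjBy ((1 : Matrix a a ℂ) ⊗ₖ R⁻¹)
  -- `R` acts on the memory and the twirl on the slot; the `R` inserted here cancels the `R⁻¹` in
  -- `B'`.
  let A' := encoderTwirl μ hU hV (conjBy ((1 : Matrix a a ℂ) ⊗ₖ R) ∘ₗ A)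
  have hA' : IsCompletelyPositive A' :=
    ((isCompletelyPositive_conjBy _).comp hA).encoderTwirl hU hV
  have hout : gateOutput U A' B' = rightTwirl μ V (leftTwirl μ V (gateOutput U A B)) := by
    rw [gateOutput_encoderTwirl, gateOutput_conj_memory hR, gateOutput_decoderTwirl]
  have hσ := continuous_gateOutput hU A B
  have hσ' : Continuous (leftTwirl μ V (gateOutput U A B)) := by
    rw [← gateOutput_decoderTwirl hU hV]
    exact continuous_gateOutput hU _ _
  obtain ⟨c, hc⟩ := exists_trace_encoderTwirl_eq (μ := μ)
    (A := conjBy ((1 : Matrix a a ℂ) ⊗ₖ R) ∘ₗ A) hU hV hirrV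
  -- `B'` and the gate preserve traces, so the whole success probability sits in `A'`.
  have hcp : c = (p : ℂ) := by
    rw [eq_reTrace_of_trace_eq (posSemidef_gateOutput hA' hB'.completelyPositive 1)
      (trace_gateOutput (U := U) hc hB'.trace_map 1), hout, reTrace_rightTwirl_leftTwirl hV hσ hσ']
  refine ⟨p⁻¹ • A', B', ⟨hA'.smul (inv_nonneg.2 hp.le), fun X => ?_⟩, hB', ?_⟩
  · rw [LinearMap.smul_apply, Matrix.trace_smul, hc, hcp, Complex.real_smul, ← mul_assoc,
      ← Complex.ofReal_mul, inv_mul_cancel₀ hp.ne', Complex.ofReal_one, one_mul]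
  · have hov : ∀ g, overlap (bellVecOf (V g : Matrix b b ℂ)) (gateOutput U (p⁻¹ • A') B' g) =
        (∫ g, overlap (bellVecOf (V g : Matrix b b ℂ)) (gateOutput U A B g) ∂μ) / p := fun g => by
      rw [gateOutput_smul, overlap_smul, hout, integral_overlap_rightTwirl_leftTwirl hV hσ hσ',
        inv_mul_eq_div]
    rw [detFidelity]
    simp only [hov, integral_const, probReal_univ, one_smul]

end NetworkTwirl

/-! ### Comparison of probabilistic and deterministic networks. -/

section Gate

theorem le_of_forall_pos_add_mul_le {x y u v : ℝ}
    (h : ∀ ε > 0, x + ε * u ≤ y + ε * v) : x ≤ y := by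
  by_contra! hlt
  have hpos : 0 < |v - u| + 1 := by positivity
  -- This `ε` makes `ε * (v - u)` smaller than the assumed gap `x - y`; the `+ 1` keeps the
  -- denominator positive.
  have h1 := h ((x - y) / (|v - u| + 1)) (div_pos (sub_pos.2 hlt) hpos)
  have h2 : (x - y) / (|v - u| + 1) * (v - u) < x - y := by
    rw [div_mul_eq_mul_div, div_lt_iff₀ hpos]
    exact mul_lt_mul_of_pos_left ((le_abs_self _).trans_lt (lt_add_one _)) (sub_pos.2 hlt)
  linarith

variable {G : Type*} [Group G] [MeasurableSpace G] {μ : Measure G} [IsProbabilityMeasure μ]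
  {a b : Type*} [Fintype a] [DecidableEq a] [Fintype b] [DecidableEq b] [Nonempty b]
  {U : G →* Matrix.unitaryGroup a ℂ} {V : G →* Matrix.unitaryGroup b ℂ}

theorem trace_gateOutput_of_isChannel {m : Type*} [Fintype m] [DecidableEq m]
    {A : Matrix b b ℂ →ₗ[ℂ] Matrix (a × m) (a × m) ℂ}
    {B : Matrix (a × m) (a × m) ℂ →ₗ[ℂ] Matrix b b ℂ} (hA : IsChannel A) (hB : IsChannel B)
    (g : G) : (gateOutput U A B g).trace = 1 :=
  trace_gateOutput (fun X => by rw [hA.trace_map, one_mul]) hB.trace_map g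

theorem gateDetValues_subset_gateProbValues : gateDetValues μ U V ⊆ gateProbValues μ U V := by
  rintro F ⟨m, A, B, hA, hB, rfl⟩
  have h1 : totalSuccess μ (gateOutput U A B) = 1 :=
    totalSuccess_eq_one (trace_gateOutput_of_isChannel hA hB)
  refine ⟨m, A, B, hA.isQuantumOperation, hB.isQuantumOperation, h1.symm ▸ one_pos, ?_⟩
  rw [probFidelity_eq_div _ (posSemidef_gateOutput hA.completelyPositive hB.completelyPositive),
    h1, div_one, detFidelity]

theorem bddAbove_gateDetValues : BddAbove (gateDetValues μ U V) := by
  refine ⟨1, ?_⟩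
  rintro F ⟨m, A, B, hA, hB, rfl⟩
  exact detFidelity_le_one (fun g => star_bellVecOf_dotProduct_self (V g).2)
    (posSemidef_gateOutput hA.completelyPositive hB.completelyPositive)
    (trace_gateOutput_of_isChannel hA hB)

variable [TopologicalSpace G] [IsTopologicalGroup G] [CompactSpace G] [BorelSpace G]
  [μ.IsHaarMeasure]

/-- The given `B` may annihilate some states, which would make `S` singular. Mixing in `εB₀`
prevents this, at the price of an inequality in the limit instead of an exact replacement. -/
theorem le_sSup_of_mem_gateProbValues (hU : Continuous U) (hV : Continuous V)
    (hirrU : (toRep U).IsIrreducible) (hirrV : (toRep V).IsIrreducible) {F : ℝ}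
    (hF : F ∈ gateProbValues μ U V) : F ≤ sSup (gateDetValues μ U V) := by
  obtain ⟨m, A, B, hA, hB, hp, rfl⟩ := hF
  obtain ⟨e⟩ := ‹Nonempty b›
  have hAcp := hA.completelyPositive
  have hBcp := hB.completelyPositive
  rw [probFidelity_eq_div _ (posSemidef_gateOutput hAcp hBcp), div_le_iff₀ hp]
  set D := sSup (gateDetValues μ U V)
  let B₀ : Matrix (a × Fin m) (a × Fin m) ℂ →ₗ[ℂ] Matrix b b ℂ :=
    prepare _ (Matrix.single e e (1 : ℂ))
  have hB₀ : IsChannel B₀ := isChannel_prepare_single e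
  refine le_of_forall_pos_add_mul_le
    (u := ∫ g, overlap (bellVecOf (V g : Matrix b b ℂ)) (gateOutput U A B₀ g) ∂μ)
    (v := D * totalSuccess μ (gateOutput U A B₀)) fun ε hε => ?_
  -- The perturbed map may increase traces, but only complete positivity and the lower bound on
  -- traces are needed from here on.
  have hcp : IsCompletelyPositive (B + ε • B₀) := hBcp.add (hB₀.completelyPositive.smul hε.le)
  have hσ := continuous_gateOutput hU A B
  have hσ₀ := continuous_gateOutput hU A B₀
  have hsucc : totalSuccess μ (gateOutput U A (B + ε • B₀)) =
      totalSuccess μ (gateOutput U A B) + ε * totalSuccess μ (gateOutput U A B₀) := by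
    simp only [totalSuccess, gateOutput_add_smul, reTrace_add, reTrace_smul]
    rw [integral_add (integrable_of_continuous μ (continuous_reTrace hσ))
      ((integrable_of_continuous μ (continuous_reTrace hσ₀)).const_mul ε), integral_const_mul]
  have hov : ∫ g, overlap (bellVecOf (V g : Matrix b b ℂ)) (gateOutput U A (B + ε • B₀) g) ∂μ =
      ∫ g, overlap (bellVecOf (V g : Matrix b b ℂ)) (gateOutput U A B g) ∂μ +
        ε * ∫ g, overlap (bellVecOf (V g : Matrix b b ℂ)) (gateOutput U A B₀ g) ∂μ := by
    simp only [gateOutput_add_smul, overlap_add, overlap_smul]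
    rw [integral_add (integrable_of_continuous μ (continuous_overlap_bellVecOf hV hσ))
      ((integrable_of_continuous μ (continuous_overlap_bellVecOf hV hσ₀)).const_mul ε),
      integral_const_mul]
  have hp₀ : 0 ≤ totalSuccess μ (gateOutput U A B₀) :=
    integral_nonneg fun g => reTrace_nonneg (posSemidef_gateOutput hAcp hB₀.completelyPositive g)
  have hp' : 0 < totalSuccess μ (gateOutput U A (B + ε • B₀)) := by
    rw [hsucc]
    exact add_pos_of_pos_of_nonneg hp (mul_nonneg hε.le hp₀)
  have hbound : ∀ Y : Matrix (a × Fin m) (a × Fin m) ℂ, Y.PosSemidef →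
      ε * reTrace Y ≤ reTrace ((B + ε • B₀) Y) := fun Y hY => by
    rw [LinearMap.add_apply, LinearMap.smul_apply, reTrace_add, reTrace_smul,
      reTrace.eq_def (B₀ Y), hB₀.trace_map]
    exact le_add_of_nonneg_left (reTrace_nonneg (hBcp.posSemidef_map hY))
  obtain ⟨A', B', hA', hB', hfid⟩ := exists_channels_detFidelity_eq (V := V) hU hV hirrU hirrV
    hAcp hcp hε hbound hp'
  have hle : detFidelity μ (fun g => bellVecOf (V g : Matrix b b ℂ)) (gateOutput U A' B') ≤ D :=
    le_csSup bddAbove_gateDetValues ⟨m, A', B', hA', hB', rfl⟩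
  -- With denominators cleared, both sides are affine in `ε`.
  rw [hfid, div_le_iff₀ hp', hov, hsucc, mul_add, mul_left_comm] at hle
  exact hle

theorem isLUB_gateFidelity (hU : Continuous U) (hV : Continuous V)
    (hirrU : (toRep U).IsIrreducible) (hirrV : (toRep V).IsIrreducible) :
    IsLUB (gateDetValues μ U V) (gateDetFidelity μ U V) ∧
      IsLUB (gateProbValues μ U V) (gateProbFidelity μ U V) ∧
      gateDetFidelity μ U V = gateProbFidelity μ U V := by
  obtain ⟨e⟩ := nonempty_of_isIrreducible hirrU
  obtain ⟨f⟩ := ‹Nonempty b›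
  -- A one-dimensional memory and two channels that prepare fixed states show that deterministic
  -- networks exist.
  exact isLUB_sSup_and_eq gateDetValues_subset_gateProbValues
    ⟨_, 1, _, _, isChannel_prepare_single (e, 0), isChannel_prepare_single f, rfl⟩
    bddAbove_gateDetValues fun F hF => le_sSup_of_mem_gateProbValues hU hV hirrU hirrV hF

end Gate

end BellConversion

theorem theorem5 {G : Type*} [Group G] [TopologicalSpace G] [IsTopologicalGroup G]
    [CompactSpace G] [MeasurableSpace G] [BorelSpace G]
    (μ : Measure G) [μ.IsHaarMeasure] [IsProbabilityMeasure μ]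
    {a b : Type*} [Fintype a] [DecidableEq a] [Fintype b] [DecidableEq b] [Nonempty b]
    (U : G →* Matrix.unitaryGroup a ℂ) (V : G →* Matrix.unitaryGroup b ℂ)
    (hU : Continuous U) (hV : Continuous V) :
    ((BellConversion.toRep U).IsIrreducible →
      IsLUB (BellConversion.bellDetValues μ U V) (BellConversion.bellDetFidelity μ U V) ∧
      IsLUB (BellConversion.bellProbValues μ U V) (BellConversion.bellProbFidelity μ U V) ∧
      BellConversion.bellDetFidelity μ U V = BellConversion.bellProbFidelity μ U V) ∧
    ((BellConversion.toRep U).IsIrreducible → (BellConversion.toRep V).IsIrreducible →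
      IsLUB (BellConversion.gateDetValues μ U V) (BellConversion.gateDetFidelity μ U V) ∧
      IsLUB (BellConversion.gateProbValues μ U V) (BellConversion.gateProbFidelity μ U V) ∧
      BellConversion.gateDetFidelity μ U V = BellConversion.gateProbFidelity μ U V) :=
  ⟨BellConversion.isLUB_bellFidelity hU hV, BellConversion.isLUB_gateFidelity hU hV⟩
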